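/- Let $F\mid\mathbb F_q$ be an algebraic function field of one variable, let $s\ge 1$, and let $H_1,\dots,H_s$ be subgroups of $\mathrm{Aut}(F\mid\mathbb F_q)$ with $\#H_i=r_i+1$ and with internal direct product $G=H_1\times\cdots\times H_s\le \mathrm{Aut}(F\mid\mathbb F_q)$. Choose $m$ rational (degree one) places of the fixed field $F^G$ that split completely in $F\mid F^G$, let $\mathcal P$ be the set of all places of $F$ lying over them, and put $n=m\prod_{i=1}^s(r_i+1)$. Let $P_\infty$ be a rational place of $F$ that is totally ramified in $F\mid F^G$, and let $Q_\infty^{(i)}=P_\infty\cap F^{H_i}$. Suppose that for $i=1,\dots,s$ there are functions $z_i,w_i$ such that (i) $z_i\in F^{H_i}$ and the pole divisor of $z_i$ in $F^{H_i}$ has support $\{Q_\infty^{(i)}\}$; (ii) $w_i\in F\setminus F^{H_i}$ and the pole divisor of $w_i$ has support $\{P_\infty\}$; (iii) for every $P\in\mathcal P$ the map $P'\mapsto w_i(P')$ is injective on the orbit $P^{H_i}=\{\sigma(P):\sigma\in H_i\}$. Let $1\le d\le n$ and $t_i\ge 1$ be integers such that, for every $i$, $$V_i:=\Bigl\{\sum_{\ell=0}^{r_i-1}\Bigl(\sum_{j=0}^{t_i}a_{\ell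 j}z_i^j\Bigr)w_i^\ell : a_{\ell j}\in\mathbb F_q\Bigr\}\subseteq \mathcal L\bigl((n-d)P_\infty\bigr),$$ and suppose that $V:=\bigcap_{i=1}^sV_i$ has $\dim_{\mathbb F_q}V>0$. Then $\mathcal P$ consists of exactly $n$ places, all of them rational and none of them a pole of a function in $V$, and for every enumeration $\mathcal P=\{P_1,\dots,P_n\}$ the set $C=\{(f(P_1),\dots,f(P_n)): f\in V\}$ is an $[n,\dim_{\mathbb F_q}V,\ge d;\,r_1,\dots,r_s]$ locally recoverable code. That is, $C$ is a linear subspace of $\mathbb F_q^n$ of dimension $\dim_{\mathbb F_q}V$ and minimum distance at least $d$, and it has a generator matrix with columns $g_1,\dots,g_n$ such that for every $a\in\{1,\dots,n\}$ there are pairwise disjoint sets $R_1,\dots,R_s\subseteq\{1,\dots,n\}\setminus\{a\}$ with $\#R_i=r_i$ and $g_a\in\langle g_b : b\in R_i\rangle$. Moreover, for every $a$ the sets $R_i(a)=\{b\ne a: P_b\in P_a^{H_i}\}$, $i=1,\dots,s$, are pairwise disjoint with $\#R_i(a)=r_i$, and for every $f\in V$ and every $i$ the value $f(P_a)$ is recovered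 by Lagrange interpolation: $f(P_a)=h(w_i(P_a))$, where $h\in\mathbb F_q[X]$ is the polynomial of degree less than $r_i$ with $h(w_i(P_b))=f(P_b)$ for all $b\in R_i(a)$. -/

import Mathlib

noncomputable section

namespace LRC

section Places

/-- `F | K` is an algebraic function field of one variable. -/
def IsFunctionField (K F : Type*) [Field K] [Field F] [Algebra K F] : Prop :=
  ∃ x : F, Transcendental K x ∧ FiniteDimensional (IntermediateField.adjoin K {x}) F

/-- A place of `F | K`, given by its valuation ring `K ⊆ 𝒪 ⊊ F`
(the place itself is the maximal ideal of that ring). -/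
@[ext]
structure Place (K F : Type*) [Field K] [Field F] [Algebra K F] where
  /-- the valuation ring of the place -/
  ring : ValuationSubring F
  const_mem : ∀ a : K, algebraMap K F a ∈ ring
  ne_top : ring ≠ ⊤

namespace Place

variable {K F : Type*} [Field K] [Field F] [Algebra K F]

instance (P : Place K F) : Algebra K P.ring :=
  ((algebraMap K F).codRestrict P.ring P.const_mem).toAlgebra

/-- The degree of a place: the degree of its residue field over `K`. -/
def degree (P : Place K F) : ℕ :=
  Module.finrank K (IsLocalRing.ResidueField P.ring)

/-- A rational place is a place of degree one. -/
def IsRational (P : Place K F) : Prop := P.degree = 1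

open Classical in
/-- The normalized discrete valuation `v_P`: `v_P (t ^ n * u) = n` for a generator `t` of the
maximal ideal and a unit `u` of the valuation ring, and `v_P 0 = ∞`. -/
def ord (P : Place K F) (x : F) : WithTop ℤ :=
  if h : ∃ n : ℤ, ∃ t u : P.ring,
      IsLocalRing.maximalIdeal P.ring = Ideal.span {t} ∧ IsUnit u ∧ x = (t : F) ^ n * (u : F)
  then ((h.choose : ℤ) : WithTop ℤ)
  else ⊤

open Classical in
/-- The value `f(P)` in `K` of a function `f` at a rational place `P` that is not a pole of `f`:
the element `a` of `K` for which `f - a` lies in the maximal ideal of the place. -/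
def eval (P : Place K F) (f : F) : K :=
  if h : ∃ a : K, f - algebraMap K F a ∈ P.ring.nonunits then h.choose else 0

/-- The image `σ(P)` of a place under an automorphism of `F | K`:
its valuation ring is `σ(𝒪_P) = {x | σ⁻¹ x ∈ 𝒪_P}`. -/
def map (σ : F ≃ₐ[K] F) (P : Place K F) : Place K F where
  ring := P.ring.comap (σ.symm : F →+* F)
  const_mem a := by
    rw [ValuationSubring.mem_comap]
    simpa using P.const_mem a
  ne_top h := P.ne_top <| by
    rw [eq_top_iff]
    intro x _
    have hx : σ x ∈ P.ring.comap (σ.symm : F →+* F) := by rw [h]; trivial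
    rw [ValuationSubring.mem_comap] at hx
    simpa using hx

/-- The orbit `P^H = {σ(P) | σ ∈ H}`. -/
def orbit (H : Subgroup (F ≃ₐ[K] F)) (P : Place K F) : Set (Place K F) :=
  {P' | ∃ σ ∈ H, P' = P.map σ}

variable {E : IntermediateField K F}

/-- `P` lies over `Q`, i.e. `Q = P ∩ E`. -/
def LiesOver (P : Place K F) (Q : Place K E) : Prop :=
  Q.ring = P.ring.comap (algebraMap E F)

/-- `P` is totally ramified in `F | E`: its ramification index over the place `Q = P ∩ E` of `E`
(the number `e` with `v_P = e * v_Q` on `E`) is `[F : E]`. -/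
def IsTotallyRamified (P : Place K F) (E : IntermediateField K F) : Prop :=
  ∃ Q : Place K E, P.LiesOver Q ∧ ∀ x : E, P.ord (x : F) = Module.finrank E F • Q.ord x

/-- A place `Q` of `E` is completely split in `F | E`:
there are exactly `[F : E]` places of `F` lying over it. -/
def IsCompletelySplit (Q : Place K E) : Prop :=
  0 < Module.finrank E F ∧ {P : Place K F | P.LiesOver Q}.ncard = Module.finrank E F

end Place

variable {K F : Type*} [Field K] [Field F] [Algebra K F]

/-- The support of the pole divisor of `f`: the places whose valuation ring does not
contain `f`. -/
def poles (K : Type*) {F : Type*} [Field K] [Field F] [Algebra K F] (f : F) : Set (Place K F) :=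
  {P | f ∉ P.ring}

/-- Divisors of `F | K`. -/
abbrev Divisor (K F : Type*) [Field K] [Field F] [Algebra K F] := Place K F →₀ ℤ

/-- The Riemann-Roch space `ℒ(D)`: zero and the functions `f` with `(f) ≥ -D`. -/
def riemannRoch (D : Divisor K F) : Set F :=
  {f | ∀ P : Place K F, ((-(D P) : ℤ) : WithTop ℤ) ≤ P.ord f}

/-- The space of all `∑_{ℓ < r} (∑_{j ≤ t} a_{ℓ j} z ^ j) w ^ ℓ` with coefficients in `K`. -/
def codeSpace (K : Type*) {F : Type*} [Field K] [Field F] [Algebra K F]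
    (r t : ℕ) (z w : F) : Submodule K F where
  carrier := {f | ∃ a : ℕ → ℕ → K, f = ∑ l ∈ Finset.range r,
    (∑ j ∈ Finset.range (t + 1), algebraMap K F (a l j) * z ^ j) * w ^ l}
  zero_mem' := ⟨0, by simp⟩
  add_mem' := by
    rintro _ _ ⟨a, rfl⟩ ⟨b, rfl⟩
    exact ⟨a + b, by simp [add_mul, Finset.sum_add_distrib]⟩
  smul_mem' := by
    rintro c _ ⟨a, rfl⟩
    exact ⟨fun l j => c * a l j, by
      simp [Algebra.smul_def, Finset.mul_sum, Finset.sum_mul, mul_assoc]⟩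

end Places

/-- `G` is the internal direct product of the subgroups `H i`. -/
def IsInternalDirectProduct {A ι : Type*} [Group A] (H : ι → Subgroup A) (G : Subgroup A) : Prop :=
  (∀ i j, i ≠ j → ∀ x ∈ H i, ∀ y ∈ H j, x * y = y * x) ∧ iSupIndep H ∧ ⨆ i, H i = G

section Codes

variable {K : Type*} [Field K] {n k s : ℕ}

/-- The rows of the `k × n` matrix `A` form a basis of the linear code `C`. -/
def IsGeneratorMatrix (A : Matrix (Fin k) (Fin n) K) (C : Submodule K (Fin n → K)) : Prop :=
  LinearIndependent K A.row ∧ Submodule.span K (Set.range A.row) = C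

open Classical in
/-- The minimum Hamming distance of a code (with value `0` if there are no two distinct
codewords). -/
def minDist (C : Submodule K (Fin n → K)) : ℕ :=
  sInf {e | ∃ x ∈ C, ∃ y ∈ C, x ≠ y ∧ e = hammingDist x y}

/-- The `a`-th coordinate of the code with generator matrix `A` has `(r_1, …, r_s)`-locality. -/
def HasLocality (A : Matrix (Fin k) (Fin n) K) (a : Fin n) (r : Fin s → ℕ) : Prop :=
  ∃ R : Fin s → Finset (Fin n), (∀ i j, i ≠ j → Disjoint (R i) (R j)) ∧
    ∀ i, a ∉ R i ∧ (R i).card = r i ∧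
      A.col a ∈ Submodule.span K (A.col '' (R i : Set (Fin n)))

/-- `C` is an `[n, k, ≥ d; r_1, …, r_s]` locally recoverable code. -/
def IsLocallyRecoverable (C : Submodule K (Fin n → K)) (k d : ℕ) (r : Fin s → ℕ) : Prop :=
  Module.finrank K C = k ∧ d ≤ minDist C ∧
    ∃ A : Matrix (Fin k) (Fin n) K, IsGeneratorMatrix A C ∧ ∀ a, HasLocality A a r

end Codes

open Classical in
/-- The coordinates `b ≠ a` for which `P b` lies in the `H`-orbit of `P a`. -/
def repairSet {K F : Type*} [Field K] [Field F] [Algebra K F] {n : ℕ}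
    (P : Fin n → Place K F) (H : Subgroup (F ≃ₐ[K] F)) (a : Fin n) : Finset (Fin n) :=
  {b | b ≠ a ∧ P b ∈ (P a).orbit H}

end LRC

end

/-!
All places of a function field `F | K` are discrete. Indeed a chain of values between `v(x) < 1`
and `1` has length at most `[F : K(x)]`, because functions taking these values are linearly
independent over `K(x)` (`linearIndependent_of_strictMono`); hence the valuation ring satisfies the
ascending chain condition on principal ideals. It follows that distinct places are independent and
weak approximation holds (`exists_approx_indicator`).

Approximation and Galois theory describe the evaluation places. A norm argument shows that `G` is
transitive on the places over a place of `F^G` (`exists_map_eq`), so over a completely split place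
it acts freely by counting (`map_injOn`): the orbit of `P` under `H_i` has `r_i + 1` places, and
the orbits for different `i` meet in `P` only, as `H_i ∩ H_j = 1`. A trace argument shows that the
places over a completely split rational place are rational (`isRational_of_isCompletelySplit`).
At the totally ramified place `P_∞` the powers `1, t, …, t ^ ([F : F^G] - 1)` of a uniformizer `t`
form a basis of `F | F^G`, and the valuation ring is generated by `t` over the one below; so `P_∞`
is alone in its fibre (`eq_of_forall_mem`). Therefore it is not an evaluation place, and `z_i`,
`w_i` and all functions in `V` are regular at the evaluation places.

On the orbit of `P` under `H_i` the function `z_i` is constant, so `f ∈ V_i` is a polynomial of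
degree less than `r_i` in `w_i` there, which the `r_i` other places determine
(`eval_eq_interpolate`). Its value at `P` is a fixed linear combination of the values at these
places, which gives the locality of the code.

The distance is the bound that a nonzero `f ∈ ℒ(k P_∞)` has at most `k` zeros (`card_zeros_le`).
It is obtained without divisor theory: `ℓ` zeros give, by approximation, `ℓ` functions linearly
independent over `K(f)` with poles only at `P_∞`, and comparing the number of products with
`1, f, …, f ^ N` with `dim ℒ(c P_∞) ≤ c + 1` (`rank_poleSpace_le`) for large `N` forces `ℓ ≤ k`.
-/

namespace LRC

/-! ### Function fields are finite over every rational subfield -/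

section FunctionField

open scoped IntermediateField.algebraAdjoinAdjoin

variable {K F : Type*} [Field K] [Field F] [Algebra K F]

theorem IsFunctionField.essFiniteType (hF : IsFunctionField K F) : Algebra.EssFiniteType K F := by
  obtain ⟨x, -, hfin⟩ := hF
  have : Algebra.EssFiniteType K (IntermediateField.adjoin K {x}) :=
    IntermediateField.essFiniteType_iff.2 ⟨{x}, by simp⟩
  exact Algebra.EssFiniteType.comp K (IntermediateField.adjoin K {x}) F

theorem IsFunctionField.trdeg_le_one (hF : IsFunctionField K F) : Algebra.trdeg K F ≤ 1 := by
  obtain ⟨x, -, hfin⟩ := hF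
  have : Algebra.IsAlgebraic (Algebra.adjoin K {x}) F :=
    Algebra.IsAlgebraic.trans (Algebra.adjoin K {x}) (IntermediateField.adjoin K {x}) F
  simpa using Algebra.IsAlgebraic.trdeg_le_cardinalMk K ({x} : Set F)

theorem IsFunctionField.isAlgebraic_adjoin (hF : IsFunctionField K F) {x : F}
    (hx : Transcendental K x) : Algebra.IsAlgebraic (Algebra.adjoin K {x}) F := by
  have h := AlgebraicIndependent.isTranscendenceBasis_of_lift_trdeg_le_of_finite
    (algebraicIndependent_iff_transcendental.2 hx) (by simpa using hF.trdeg_le_one)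
  have := h.isAlgebraic
  rwa [Matrix.range_cons, Matrix.range_empty, Set.union_empty] at this

theorem IsFunctionField.finiteDimensional (hF : IsFunctionField K F) {x : F}
    (hx : Transcendental K x) : FiniteDimensional (IntermediateField.adjoin K {x}) F := by
  have := hF.isAlgebraic_adjoin hx
  have : Algebra.IsAlgebraic (IntermediateField.adjoin K {x}) F :=
    Algebra.IsAlgebraic.extendScalars (R := Algebra.adjoin K {x})
      (Subalgebra.inclusion_injective (IntermediateField.algebra_adjoin_le_adjoin K {x}))
  have := hF.essFiniteType
  have : Algebra.EssFiniteType (IntermediateField.adjoin K {x}) F :=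
    Algebra.EssFiniteType.of_comp K _ _
  obtain ⟨s, hs⟩ := IntermediateField.fg_top (IntermediateField.adjoin K {x}) F
  have : FiniteDimensional (IntermediateField.adjoin K {x})
      (IntermediateField.adjoin (IntermediateField.adjoin K {x}) (s : Set F)) :=
    IntermediateField.finiteDimensional_adjoin fun y _ => Algebra.IsIntegral.isIntegral y
  rw [hs] at this
  exact Module.Finite.equiv IntermediateField.topEquiv.toLinearEquiv

/-- A relation with coefficients in `K[x]` can be divided by `x` indefinitely as soon as `x`
divides the coefficients of every relation, so there is no nontrivial relation. -/
theorem eq_zero_of_forall_X_dvd {ι : Type*} [Fintype ι] {x : F} (hx : x ≠ 0) {g : ι → F}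
    (h : ∀ φ : ι → Polynomial K, ∑ i, Polynomial.aeval x (φ i) * g i = 0 →
      ∀ i, Polynomial.X ∣ φ i)
    (φ : ι → Polynomial K) (hφ : ∑ i, Polynomial.aeval x (φ i) * g i = 0) (i : ι) : φ i = 0 := by
  have key : ∀ n : ℕ, ∀ φ : ι → Polynomial K, ∑ i, Polynomial.aeval x (φ i) * g i = 0 →
      ∀ i, Polynomial.X ^ n ∣ φ i := by
    intro n
    induction n with
    | zero => simp
    | succ n ih =>
      intro φ hφ
      choose ψ hψ using h φ hφ
      have : ∑ i, Polynomial.aeval x (ψ i) * g i = 0 := by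
        have h2 : x * ∑ i, Polynomial.aeval x (ψ i) * g i = 0 := by
          rw [Finset.mul_sum, ← hφ]
          refine Finset.sum_congr rfl fun i _ => ?_
          rw [hψ i]; simp [mul_assoc]
        exact (mul_eq_zero.1 h2).resolve_left hx
      intro i
      rw [hψ i, pow_succ']
      exact mul_dvd_mul_left _ (ih ψ this i)
  ext n
  exact Polynomial.X_pow_dvd_iff.1 (key (n + 1) φ hφ i) n n.lt_succ_self

theorem linearIndependent_adjoin_of_forall_X_dvd {ι : Type*} [Fintype ι] {x : F} (hx : x ≠ 0)
    {g : ι → F}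
    (h : ∀ φ : ι → Polynomial K, ∑ i, Polynomial.aeval x (φ i) * g i = 0 →
      ∀ i, Polynomial.X ∣ φ i) :
    LinearIndependent (IntermediateField.adjoin K {x}) g := by
  rw [← LinearIndependent.iff_fractionRing (Algebra.adjoin K {x}), Fintype.linearIndependent_iff]
  intro c hc i
  have hex : ∀ i, ∃ φ : Polynomial K, Polynomial.aeval x φ = (c i : F) := fun i =>
    (SetLike.ext_iff.1 (Algebra.adjoin_singleton_eq_range_aeval K x) _).1 (c i).2
  choose φ hφ using hex
  have h0 : φ i = 0 := eq_zero_of_forall_X_dvd hx h φ (by simp_rw [hφ]; exact hc) i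
  exact Subtype.ext (by rw [← hφ i, h0]; simp)

end FunctionField

/-! ### The valuation ring of a place is discrete -/

theorem mem_of_isIntegral {S F : Type*} [CommRing S] [Field F] [Algebra S F]
    (A : ValuationSubring F) (h : ∀ s : S, algebraMap S F s ∈ A) {x : F} (hx : IsIntegral S x) :
    x ∈ A := by
  obtain ⟨p, hp, hpx⟩ := hx
  have hA : IsIntegral A x := by
    refine ⟨p.map ((algebraMap S F).codRestrict A h), hp.map _, ?_⟩
    rw [Polynomial.eval₂_map]
    exact hpx
  obtain ⟨y, rfl⟩ := (IsIntegrallyClosed.isIntegral_iff (R := A) (K := F)).1 hA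
  exact y.2

namespace Place

variable {K F : Type*} [Field K] [Field F] [Algebra K F] (P P' : Place K F)

/-- The valuation of a place; its values are written multiplicatively, so that `x` is regular at
`P` iff `P.val x ≤ 1` and vanishes at `P` iff `P.val x < 1`. -/
noncomputable abbrev val : Valuation F P.ring.ValueGroup := P.ring.valuation

theorem mem_ring_iff {x : F} : x ∈ P.ring ↔ P.val x ≤ 1 := (P.ring.valuation_le_one_iff x).symm

theorem val_const_le (a : K) : P.val (algebraMap K F a) ≤ 1 := P.mem_ring_iff.1 (P.const_mem a)

theorem val_const {a : K} (ha : a ≠ 0) : P.val (algebraMap K F a) = 1 := by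
  refine le_antisymm (P.val_const_le a) ?_
  have h := P.val_const_le a⁻¹
  rw [map_inv₀, map_inv₀] at h
  have h0 : P.val (algebraMap K F a) ≠ 0 := by simpa using ha
  exact (inv_le_one₀ (zero_lt_iff.2 h0)).1 h

theorem mem_of_isAlgebraic {x : F} (hx : IsAlgebraic K x) : x ∈ P.ring :=
  mem_of_isIntegral P.ring P.const_mem hx.isIntegral

theorem val_eq_one_of_isAlgebraic {x : F} (hx : IsAlgebraic K x) (h0 : x ≠ 0) : P.val x = 1 := by
  refine le_antisymm (P.mem_ring_iff.1 (P.mem_of_isAlgebraic hx)) ?_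
  have h := P.mem_ring_iff.1 (P.mem_of_isAlgebraic hx.inv)
  rw [map_inv₀] at h
  exact (inv_le_one₀ (zero_lt_iff.2 ((P.val.ne_zero_iff).2 h0))).1 h

theorem transcendental_of_val_lt_one {x : F} (h0 : x ≠ 0) (h : P.val x < 1) :
    Transcendental K x := fun hx => h.ne (P.val_eq_one_of_isAlgebraic hx h0)

theorem val_aeval_le {x : F} (hx : P.val x ≤ 1) (φ : Polynomial K) :
    P.val (Polynomial.aeval x φ) ≤ 1 := by
  rw [← mem_ring_iff] at hx ⊢
  rw [Polynomial.aeval_eq_sum_range]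
  refine sum_mem fun i _ => ?_
  rw [Algebra.smul_def]
  exact mul_mem (P.const_mem _) (pow_mem hx i)

theorem val_aeval_eq_one {x : F} (hx : P.val x < 1) {φ : Polynomial K} (hφ : φ.coeff 0 ≠ 0) :
    P.val (Polynomial.aeval x φ) = 1 := by
  have hlt : P.val (x * Polynomial.aeval x φ.divX) < 1 := by
    rw [map_mul]
    exact mul_lt_one_of_lt_of_le hx (P.val_aeval_le hx.le _)
  rw [← Polynomial.X_mul_divX_add φ, map_add, map_mul, Polynomial.aeval_X, Polynomial.aeval_C,
    Valuation.map_add_eq_of_lt_right _ (by rwa [P.val_const hφ]), P.val_const hφ]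

/-- A strictly increasing chain of values in `[v(x), 1)` has length at most `[F : K(x)]`: functions
with these values are linearly independent over `K(x)`. -/
theorem linearIndependent_of_strictMono {x : F} (hx0 : x ≠ 0) (hx : P.val x < 1) {N : ℕ}
    {g : Fin N → F} (hg : StrictMono fun i => P.val (g i)) (hg1 : ∀ i, P.val (g i) < 1)
    (hgx : ∀ i, P.val x ≤ P.val (g i)) :
    LinearIndependent (IntermediateField.adjoin K {x}) g := by
  refine linearIndependent_adjoin_of_forall_X_dvd hx0 fun φ hφ => ?_
  classical
  by_contra hcon
  simp_rw [Polynomial.X_dvd_iff] at hcon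
  push Not at hcon
  -- the last index whose coefficient does not vanish at `x = 0` carries the dominant term
  obtain ⟨j, hj, hmax⟩ := Finset.exists_max_image
    (Finset.univ.filter fun i => (φ i).coeff 0 ≠ 0) id
    (by obtain ⟨i, hi⟩ := hcon; exact ⟨i, by simpa using hi⟩)
  simp only [Finset.mem_filter, Finset.mem_univ, true_and, id] at hj hmax
  have hpos : 0 < P.val (g j) := (zero_lt_iff.2 ((P.val.ne_zero_iff).2 hx0)).trans_le (hgx j)
  have hunit := P.val_aeval_eq_one hx hj
  have hlt : ∀ i ∈ Finset.univ.erase j,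
      P.val (Polynomial.aeval x (φ i) * g i) < P.val (g j) := by
    intro i hi
    rw [map_mul]
    rcases lt_or_gt_of_ne (Finset.ne_of_mem_erase hi) with h | h
    · exact (mul_le_of_le_one_left' (P.val_aeval_le hx.le _)).trans_lt (hg h)
    · have h0 : (φ i).coeff 0 = 0 := by
        by_contra h0
        exact absurd (hmax i h0) (not_le.2 h)
      obtain ⟨ψ, hψ⟩ := Polynomial.X_dvd_iff.2 h0
      rw [hψ, map_mul, map_mul, Polynomial.aeval_X]
      calc _ ≤ P.val x * P.val (g i) :=
            mul_le_mul_left (mul_le_of_le_one_right' (P.val_aeval_le hx.le _)) _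
        _ < P.val x := mul_lt_of_lt_one_right (zero_lt_iff.2 ((P.val.ne_zero_iff).2 hx0)) (hg1 i)
        _ ≤ _ := hgx j
  rw [← Finset.add_sum_erase _ _ (Finset.mem_univ j)] at hφ
  have := P.val.map_sum_lt hpos.ne' hlt
  rw [← eq_neg_iff_add_eq_zero] at hφ
  have h2 : P.val (Polynomial.aeval x (φ j) * g j) = P.val (g j) := by
    rw [map_mul, hunit, one_mul]
  rw [hφ, Valuation.map_neg] at h2
  exact this.ne h2

theorem isDiscreteValuationRing (hF : IsFunctionField K F) :
    IsDiscreteValuationRing P.ring := by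
  have hwf : WfDvdMonoid P.ring := by
    constructor
    rw [wellFounded_iff_isEmpty_descending_chain]
    refine ⟨fun ⟨e, he⟩ => ?_⟩
    have hval : ∀ n, P.val (e n : F) < P.val (e (n + 1) : F) := by
      intro n
      obtain ⟨h0, y, hy, hey⟩ := he n
      rw [hey]
      push_cast
      rw [map_mul]
      refine mul_lt_of_lt_one_right (zero_lt_iff.2 ((P.val.ne_zero_iff).2 ?_)) ?_
      · simpa using h0
      · rw [← P.ring.valuation_lt_one_iff]
        exact (IsLocalRing.mem_maximalIdeal _).2 hy
    have hmono : StrictMono fun n => P.val (e n : F) := strictMono_nat_of_lt_succ hval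
    have h0 : (e 1 : F) ≠ 0 := by
      intro h
      have := hval 0
      simp [h] at this
    have hlt : ∀ n, P.val (e n : F) < 1 := fun n =>
      (hval n).trans_le (P.mem_ring_iff.1 (e (n + 1)).2)
    have hfd := hF.finiteDimensional (P.transcendental_of_val_lt_one h0 (hlt 1))
    have hli := P.linearIndependent_of_strictMono h0 (hlt 1)
      (N := Module.finrank (IntermediateField.adjoin K {(e 1 : F)}) F + 1)
      (g := fun i => (e (i + 1) : F))
      (fun i j hij => hmono (Nat.succ_lt_succ hij)) (fun i => hlt _)
      (fun i => hmono.monotone (by omega))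
    have := hli.fintype_card_le_finrank
    simp at this
  have hpid : IsPrincipalIdealRing P.ring := ((IsBezout.TFAE (R := P.ring)).out 3 1).1 hwf
  have hnf : ¬ IsField P.ring := by
    intro h
    refine P.ne_top (eq_top_iff.2 fun x _ => ?_)
    rcases P.ring.mem_or_inv_mem x with hx | hx
    · exact hx
    by_cases h0 : x = 0
    · rw [h0]; exact P.ring.zero_mem
    obtain ⟨b, hb⟩ := h.mul_inv_cancel (a := ⟨x⁻¹, hx⟩) (fun h' => h0 (by simpa using congrArg Subtype.val h'))
    have : (b : F) = x := by
      have := congrArg Subtype.val hb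
      simp only [MulMemClass.coe_mul, OneMemClass.coe_one] at this
      field_simp at this
      exact this
    rw [← this]; exact b.2
  exact { hpid with not_a_field' := fun h => hnf (IsLocalRing.isField_iff_maximalIdeal_eq.2 h) }

end Place

/-! ### Uniformizers and the order function -/

namespace Place

variable {K F : Type*} [Field K] [Field F] [Algebra K F] (P P' : Place K F)

theorem val_pos {x : F} (hx : x ≠ 0) : 0 < P.val x := zero_lt_iff.2 ((P.val.ne_zero_iff).2 hx)

theorem mem_nonunits_iff {x : F} : x ∈ P.ring.nonunits ↔ P.val x < 1 := Iff.rfl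

theorem isUnit_iff_val_eq_one (u : P.ring) : IsUnit u ↔ P.val u = 1 :=
  P.ring.valuation_eq_one_iff u

/-- A uniformizer (local parameter) at `P`: a function with `v_P(t) < 1` whose integral powers
realise all values of the multiplicatively written valuation. -/
def IsUniformizer (t : F) : Prop :=
  P.val t < 1 ∧ ∀ x : F, x ≠ 0 → ∃ k : ℤ, P.val x = P.val t ^ k

variable {P} in
theorem IsUniformizer.ne_zero {t : F} (ht : P.IsUniformizer t) : t ≠ 0 := by
  rintro rfl
  refine P.ne_top (eq_top_iff.2 fun x _ => ?_)
  rcases eq_or_ne x 0 with rfl | hx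
  · exact zero_mem _
  obtain ⟨k, hk⟩ := ht.2 x hx
  rw [mem_ring_iff, hk, map_zero]
  rcases eq_or_ne k 0 with rfl | hk0
  · rw [zpow_zero]
  · rw [zero_zpow _ hk0]
    exact zero_le

variable {P} in
theorem IsUniformizer.val_pos {t : F} (ht : P.IsUniformizer t) : 0 < P.val t :=
  P.val_pos ht.ne_zero

variable {P} in
theorem IsUniformizer.zpow_le_zpow_iff {t : F} (ht : P.IsUniformizer t) {k l : ℤ} :
    P.val t ^ k ≤ P.val t ^ l ↔ l ≤ k := zpow_le_zpow_iff_right_of_lt_one₀ ht.val_pos ht.1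

theorem exists_generator (hF : IsFunctionField K F) :
    ∃ t : P.ring, IsLocalRing.maximalIdeal P.ring = Ideal.span {t} ∧
      ∀ x : F, x ≠ 0 → ∃ (k : ℤ) (u : P.ring), IsUnit u ∧ x = (t : F) ^ k * (u : F) := by
  have := P.isDiscreteValuationRing hF
  obtain ⟨t, ht⟩ := IsDiscreteValuationRing.exists_irreducible P.ring
  refine ⟨t, ht.maximalIdeal_eq, fun x hx => ?_⟩
  have aux : ∀ y : F, y ≠ 0 → y ∈ P.ring → ∃ (k : ℕ) (u : P.ringˣ), y = (t : F) ^ k * (u : P.ring) := by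
    intro y hy hmem
    obtain ⟨k, u, h⟩ := IsDiscreteValuationRing.eq_unit_mul_pow_irreducible (x := (⟨y, hmem⟩ : P.ring))
      (fun h => hy (congrArg Subtype.val h)) ht
    refine ⟨k, u, ?_⟩
    have := congrArg (Subtype.val : P.ring → F) h
    push_cast at this
    rw [this, mul_comm]
  rcases P.ring.mem_or_inv_mem x with h | h
  · obtain ⟨k, u, he⟩ := aux x hx h
    exact ⟨k, u, u.isUnit, by rw [he, zpow_natCast]⟩
  · obtain ⟨k, u, he⟩ := aux x⁻¹ (inv_ne_zero hx) h
    refine ⟨-k, (u⁻¹ : P.ringˣ), Units.isUnit _, ?_⟩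
    have hu : ((u : P.ring) : F) * ((u⁻¹ : P.ringˣ) : P.ring) = 1 := by
      have := congrArg (Subtype.val : P.ring → F) u.mul_inv
      exact this
    rw [← inv_inv x, he, mul_inv, zpow_neg, zpow_natCast, eq_inv_of_mul_eq_one_right hu]

theorem val_mul_unit (t : F) (k : ℤ) {u : P.ring} (hu : IsUnit u) :
    P.val (t ^ k * (u : F)) = P.val t ^ k := by
  rw [map_mul, (P.isUnit_iff_val_eq_one u).1 hu, mul_one, map_zpow₀]

theorem exists_isUniformizer (hF : IsFunctionField K F) : ∃ t : F, P.IsUniformizer t := by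
  obtain ⟨t, ht, h⟩ := P.exists_generator hF
  refine ⟨t, (P.ring.valuation_lt_one_iff t).1 (ht ▸ Ideal.mem_span_singleton_self t), ?_⟩
  intro x hx
  obtain ⟨k, u, hu, he⟩ := h x hx
  exact ⟨k, by rw [he, P.val_mul_unit _ _ hu]⟩

/-- Translates inequalities for `ord` into inequalities for the values of the valuation; `x = 0` is
the case where the defining existence fails and `ord` is `⊤`. -/
theorem le_ord_iff (hF : IsFunctionField K F) {t : F} (ht : P.IsUniformizer t) (k : ℤ) (x : F) :
    (k : WithTop ℤ) ≤ P.ord x ↔ P.val x ≤ P.val t ^ k := by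
  rcases eq_or_ne x 0 with rfl | hx
  · simp only [map_zero, zero_le, iff_true]
    rw [ord, dif_neg]
    · exact le_top
    rintro ⟨n, t', u, ht', hu, h0⟩
    have hu0 : (u : F) ≠ 0 := by simpa using hu.ne_zero
    have ht0 : (t' : F) = 0 := eq_zero_of_zpow_eq_zero ((mul_eq_zero.1 h0.symm).resolve_right hu0)
    have : t' = 0 := Subtype.ext ht0
    have hmem : (⟨t, P.mem_ring_iff.2 ht.1.le⟩ : P.ring) ∈ IsLocalRing.maximalIdeal P.ring :=
      (P.ring.valuation_lt_one_iff _).2 ht.1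
    rw [ht', this, Ideal.mem_span_singleton, zero_dvd_iff] at hmem
    exact ht.ne_zero (congrArg Subtype.val hmem)
  · obtain ⟨t₁, ht₁, h₁⟩ := P.exists_generator hF
    have hex : ∃ n : ℤ, ∃ t u : P.ring,
        IsLocalRing.maximalIdeal P.ring = Ideal.span {t} ∧ IsUnit u ∧ x = (t : F) ^ n * (u : F) := by
      obtain ⟨n, u, hu, he⟩ := h₁ x hx
      exact ⟨n, t₁, u, ht₁, hu, he⟩
    rw [ord, dif_pos hex]
    obtain ⟨t', u, ht', hu, he⟩ := hex.choose_spec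
    generalize hex.choose = n at he
    -- any two uniformizers have the same value
    have hval : P.val (t' : F) = P.val t := by
      refine le_antisymm ?_ ?_
      · have h' : P.val (t' : F) < 1 :=
          (P.ring.valuation_lt_one_iff t').1 (ht' ▸ Ideal.mem_span_singleton_self t')
        have h0 : (t' : F) ≠ 0 := by
          intro h0
          have hmem : (⟨t, P.mem_ring_iff.2 ht.1.le⟩ : P.ring) ∈ IsLocalRing.maximalIdeal P.ring :=
            (P.ring.valuation_lt_one_iff _).2 ht.1
          rw [ht', show t' = 0 from Subtype.ext h0, Ideal.mem_span_singleton, zero_dvd_iff] at hmem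
          exact ht.ne_zero (congrArg Subtype.val hmem)
        obtain ⟨j, hj⟩ := ht.2 _ h0
        have hj1 : ¬ j ≤ 0 := by
          rw [← ht.zpow_le_zpow_iff, zpow_zero, ← hj]
          exact not_le.2 h'
        rw [hj]
        calc _ ≤ P.val t ^ (1 : ℤ) := ht.zpow_le_zpow_iff.2 (by omega)
          _ = _ := zpow_one _
      · have hmem : (⟨t, P.mem_ring_iff.2 ht.1.le⟩ : P.ring) ∈ IsLocalRing.maximalIdeal P.ring :=
          (P.ring.valuation_lt_one_iff _).2 ht.1
        rw [ht', Ideal.mem_span_singleton] at hmem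
        obtain ⟨c, hc⟩ := hmem
        have := congrArg (Subtype.val : P.ring → F) hc
        push_cast at this
        rw [this, map_mul]
        exact mul_le_of_le_one_right' (P.mem_ring_iff.1 c.2)
    rw [he, P.val_mul_unit _ _ hu, hval, ht.zpow_le_zpow_iff, WithTop.coe_le_coe]

theorem zero_le_ord_iff (hF : IsFunctionField K F) (x : F) :
    (0 : WithTop ℤ) ≤ P.ord x ↔ x ∈ P.ring := by
  obtain ⟨t, ht⟩ := P.exists_isUniformizer hF
  have := P.le_ord_iff hF ht 0 x
  rw [zpow_zero, ← mem_ring_iff] at this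
  exact this

/-! ### Independence of places and approximation -/

/-- A discrete valuation ring is a maximal proper subring. -/
theorem eq_of_ring_le (hF : IsFunctionField K F) (h : P.ring ≤ P'.ring) : P = P' := by
  refine Place.ext (le_antisymm h fun y hy => ?_)
  by_contra hyP
  obtain ⟨t, ht⟩ := P.exists_isUniformizer hF
  have hy0 : y ≠ 0 := by rintro rfl; exact hyP (zero_mem _)
  obtain ⟨k, hk⟩ := ht.2 y hy0
  have hk0 : k ≤ -1 := by
    by_contra hk0
    refine hyP (P.mem_ring_iff.2 ?_)
    rw [hk, ← zpow_zero (P.val t), ht.zpow_le_zpow_iff]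
    omega
  -- every element is a power of `y` times an element of `P.ring`
  refine P'.ne_top (eq_top_iff.2 fun x _ => ?_)
  rcases eq_or_ne x 0 with rfl | hx
  · exact zero_mem _
  obtain ⟨j, hj⟩ := ht.2 x hx
  have hz : x * (y ^ j.natAbs)⁻¹ ∈ P.ring := by
    rw [mem_ring_iff, map_mul, map_inv₀, map_pow, hk, hj, ← zpow_natCast, ← zpow_mul, ← zpow_neg,
      ← zpow_add₀ ht.val_pos.ne', ← zpow_zero (P.val t), ht.zpow_le_zpow_iff]
    have : |j| ≤ (-k) * |j| := le_mul_of_one_le_left (abs_nonneg j) (by omega)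
    have := neg_abs_le j
    push_cast
    linarith
  have : x = x * (y ^ j.natAbs)⁻¹ * y ^ j.natAbs := by field_simp
  rw [this]
  exact mul_mem (h hz) (pow_mem hy _)

theorem exists_pow_mul_lt_one (hF : IsFunctionField K F) {a : F} (ha : P.val a < 1) (b : F) :
    ∃ N : ℕ, ∀ n ≥ N, P.val (a ^ n * b) < 1 := by
  obtain ⟨t, ht⟩ := P.exists_isUniformizer hF
  rcases eq_or_ne b 0 with rfl | hb
  · exact ⟨0, fun n _ => by simp⟩
  rcases eq_or_ne a 0 with rfl | ha0
  · exact ⟨1, fun n hn => by rw [zero_pow (by omega)]; simp⟩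
  obtain ⟨k, hk⟩ := ht.2 a ha0
  obtain ⟨j, hj⟩ := ht.2 b hb
  have hk1 : 1 ≤ k := by
    by_contra h
    refine absurd ha (not_lt.2 ?_)
    rw [hk, ← zpow_zero (P.val t), ht.zpow_le_zpow_iff]
    omega
  refine ⟨j.natAbs + 1, fun n hn => ?_⟩
  rw [map_mul, map_pow, hk, hj, ← zpow_natCast, ← zpow_mul, ← zpow_add₀ ht.val_pos.ne',
    ← zpow_zero (P.val t), ← not_le, ht.zpow_le_zpow_iff, not_le]
  have : (n : ℤ) ≤ k * n := le_mul_of_one_le_left (by positivity) hk1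
  have := neg_abs_le j
  have : (|j| + 1 : ℤ) ≤ n := by rw [Int.abs_eq_natAbs]; exact_mod_cast hn
  linarith

/-- By induction on `S`: given `a` for `S` and `b` for one more place `P`, the function
`a ^ N * b / (1 + a ^ N)` with `N` large works if `a` has a pole at `P`, and `a ^ N * b` if `a` is a
unit there. -/
theorem exists_one_lt_forall_lt_one (hF : IsFunctionField K F) (P₀ : Place K F)
    (S : Finset (Place K F)) (hS : P₀ ∉ S) :
    ∃ a : F, 1 < P₀.val a ∧ ∀ P ∈ S, P.val a < 1 := by
  classical
  induction S using Finset.induction_on with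
  | empty =>
    obtain ⟨t, ht⟩ := P₀.exists_isUniformizer hF
    refine ⟨t⁻¹, ?_, by simp⟩
    rw [map_inv₀]
    exact (one_lt_inv₀ ht.val_pos).2 ht.1
  | insert P S hPS ih =>
    rw [Finset.mem_insert, not_or] at hS
    obtain ⟨a, ha₀, ha⟩ := ih hS.2
    obtain ⟨b, hb₀, hb⟩ : ∃ b : F, 1 < P₀.val b ∧ P.val b < 1 := by
      have h1 : ¬ P₀.ring ≤ P.ring := fun h => hS.1 (P₀.eq_of_ring_le P hF h)
      have h2 : ¬ P.ring ≤ P₀.ring := fun h => hS.1 (P.eq_of_ring_le P₀ hF h).symm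
      obtain ⟨y, hy, hyP⟩ := SetLike.not_le_iff_exists.1 h1
      obtain ⟨z, hz, hzP⟩ := SetLike.not_le_iff_exists.1 h2
      rw [mem_ring_iff] at hy hz
      rw [mem_ring_iff, not_le] at hyP hzP
      have hy0 : y ≠ 0 := by rintro rfl; simp at hyP
      refine ⟨z / y, ?_, ?_⟩
      · rw [map_div₀, one_lt_div₀ (P₀.val_pos hy0)]
        exact hy.trans_lt hzP
      · rw [map_div₀, div_lt_one₀ (P.val_pos hy0)]
        exact hz.trans_lt hyP
    rcases lt_or_ge (P.val a) 1 with hPa | hPa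
    · exact ⟨a, ha₀, by simpa using ⟨hPa, ha⟩⟩
    have hex : ∃ N : ℕ, 1 ≤ N ∧ ∀ R ∈ S, R.val (a ^ N * b) < 1 := by
      have : ∀ R : Place K F, ∃ N : ℕ, R ∈ S → ∀ n ≥ N, R.val (a ^ n * b) < 1 := by
        intro R
        by_cases hR : R ∈ S
        · obtain ⟨N, hN⟩ := R.exists_pow_mul_lt_one hF (ha R hR) b
          exact ⟨N, fun _ => hN⟩
        · exact ⟨0, fun h => absurd h hR⟩
      choose N hN using this
      refine ⟨S.sup N + 1, by omega, fun R hR => hN R hR _ ?_⟩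
      exact (Finset.le_sup hR).trans (Nat.le_succ _)
    obtain ⟨N, hN1, hN⟩ := hex
    rcases hPa.eq_or_lt with hPa | hPa
    · refine ⟨a ^ N * b, ?_, ?_⟩
      · rw [map_mul, map_pow]
        exact one_lt_mul_of_le_of_lt (one_le_pow₀ ha₀.le) hb₀
      · rw [Finset.forall_mem_insert]
        refine ⟨?_, hN⟩
        rw [map_mul, map_pow, ← hPa, one_pow, one_mul]
        exact hb
    · have key : ∀ R : Place K F, 1 < R.val a → R.val (a ^ N * b / (1 + a ^ N)) = R.val b := by
        intro R hR
        have hlt : R.val 1 < R.val (a ^ N) := by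
          rw [map_one, map_pow]
          exact one_lt_pow₀ hR (by omega)
        have h0 : R.val (a ^ N) ≠ 0 := (lt_of_le_of_lt zero_le hlt).ne'
        rw [map_div₀, Valuation.map_add_eq_of_lt_right _ hlt, map_mul,
          mul_div_cancel_left₀ _ h0]
      refine ⟨a ^ N * b / (1 + a ^ N), by rwa [key P₀ ha₀], ?_⟩
      rw [Finset.forall_mem_insert, key P hPa]
      refine ⟨hb, fun R hR => ?_⟩
      have hlt : R.val (a ^ N) < R.val 1 := by
        rw [map_one, map_pow]
        exact pow_lt_one₀ zero_le (ha R hR) (by omega)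
      rw [map_div₀, Valuation.map_add_eq_of_lt_left _ hlt, map_one, div_one]
      exact hN R hR

theorem exists_approx (hF : IsFunctionField K F) (P₀ : Place K F)
    (S : Finset (Place K F)) (hS : P₀ ∉ S) :
    ∃ x : F, P₀.val (x - 1) < 1 ∧ ∀ P ∈ S, P.val x < 1 := by
  obtain ⟨a, ha₀, ha⟩ := exists_one_lt_forall_lt_one hF P₀ S hS
  have h0 : 1 + a ≠ 0 := by
    intro h
    rw [← eq_neg_of_add_eq_zero_right h |>.symm, Valuation.map_neg, map_one] at ha₀
    exact lt_irrefl _ ha₀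
  refine ⟨a / (1 + a), ?_, fun P hP => ?_⟩
  · have : a / (1 + a) - 1 = -(1 + a)⁻¹ := by field_simp; ring
    rw [this, Valuation.map_neg, map_inv₀, Valuation.map_add_eq_of_lt_right _ (by simpa using ha₀)]
    exact inv_lt_one_of_one_lt₀ ha₀
  · rw [map_div₀, Valuation.map_add_eq_of_lt_left _ (by simpa using ha P hP), map_one, div_one]
    exact ha P hP

/-- Weak approximation of the indicator function of `T` on a finite set of places. -/
theorem exists_approx_indicator (hF : IsFunctionField K F) (T S : Finset (Place K F))
    (hTS : Disjoint T S) :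
    ∃ x : F, (∀ P ∈ T, P.val (x - 1) < 1) ∧ ∀ P ∈ S, P.val x < 1 := by
  classical
  have : ∀ P₀ : Place K F, ∃ x : F, P₀.val (x - 1) < 1 ∧ ∀ P ∈ (T ∪ S).erase P₀, P.val x < 1 :=
    fun P₀ => exists_approx hF P₀ _ (by simp)
  choose x hx1 hx using this
  refine ⟨∑ P ∈ T, x P, fun P hP => ?_, fun P hP => ?_⟩
  · rw [← Finset.add_sum_erase _ _ hP, add_sub_right_comm]
    refine P.val.map_add_lt (hx1 P) (P.val.map_sum_lt one_ne_zero fun R hR => ?_)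
    rw [Finset.mem_erase] at hR
    exact hx R P (by simp [hR.1.symm, hP])
  · refine P.val.map_sum_lt one_ne_zero fun R hR => hx R P ?_
    have : P ≠ R := fun h => Finset.disjoint_left.1 hTS hR (h ▸ hP)
    simp [this, hP]

end Place

namespace Place

variable {K F : Type*} [Field K] [Field F] [Algebra K F] (P P' : Place K F)

/-! ### Values at rational places -/

theorem isRational_iff : P.IsRational ↔ ∀ x ∈ P.ring, ∃ a : K, P.val (x - algebraMap K F a) < 1 := by
  have hres : ∀ (y : P.ring) (c : K), c • (1 : IsLocalRing.ResidueField P.ring) =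
      IsLocalRing.residue P.ring y ↔ P.val ((y : F) - algebraMap K F c) < 1 := by
    intro y c
    have hc : c • (1 : IsLocalRing.ResidueField P.ring) =
        IsLocalRing.residue P.ring (algebraMap K P.ring c) := by
      rw [Algebra.smul_def, mul_one]
      rfl
    rw [hc, eq_comm, ← sub_eq_zero, ← map_sub, IsLocalRing.residue_eq_zero_iff,
      P.ring.valuation_lt_one_iff]
    rfl
  rw [IsRational, degree, finrank_eq_one_iff_of_nonzero' (1 : IsLocalRing.ResidueField P.ring)
    one_ne_zero]
  constructor
  · intro h x hx
    obtain ⟨c, hc⟩ := h (IsLocalRing.residue P.ring ⟨x, hx⟩)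
    exact ⟨c, (hres _ c).1 hc⟩
  · intro h y
    obtain ⟨y, rfl⟩ := IsLocalRing.residue_surjective y
    obtain ⟨c, hc⟩ := h y y.2
    exact ⟨c, (hres y c).2 hc⟩

theorem const_unique {x : F} {a b : K} (ha : P.val (x - algebraMap K F a) < 1)
    (hb : P.val (x - algebraMap K F b) < 1) : a = b := by
  by_contra hab
  have h : P.val (algebraMap K F (b - a)) = 1 := P.val_const (sub_ne_zero.2 (Ne.symm hab))
  rw [map_sub, ← sub_sub_sub_cancel_left _ _ x] at h
  exact (P.val.map_sub_lt ha hb).ne h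

theorem eval_eq_iff {x : F} (hP : P.IsRational) (hx : x ∈ P.ring) {a : K} :
    P.eval x = a ↔ P.val (x - algebraMap K F a) < 1 := by
  have hex : ∃ a : K, x - algebraMap K F a ∈ P.ring.nonunits := P.isRational_iff.1 hP x hx
  have h : P.val (x - algebraMap K F (P.eval x)) < 1 := by
    rw [eval, dif_pos hex]
    exact hex.choose_spec
  exact ⟨fun he => he ▸ h, fun ha => P.const_unique h ha⟩

theorem val_sub_eval_lt_one {x : F} (hP : P.IsRational) (hx : x ∈ P.ring) :
    P.val (x - algebraMap K F (P.eval x)) < 1 := (P.eval_eq_iff hP hx).1 rfl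

theorem eval_const (hP : P.IsRational) (a : K) : P.eval (algebraMap K F a) = a := by
  rw [P.eval_eq_iff hP (P.const_mem a)]; simp

theorem eval_add {x y : F} (hP : P.IsRational) (hx : x ∈ P.ring) (hy : y ∈ P.ring) :
    P.eval (x + y) = P.eval x + P.eval y := by
  rw [P.eval_eq_iff hP (add_mem hx hy), map_add, add_sub_add_comm]
  exact P.val.map_add_lt (P.val_sub_eval_lt_one hP hx) (P.val_sub_eval_lt_one hP hy)

theorem eval_mul {x y : F} (hP : P.IsRational) (hx : x ∈ P.ring) (hy : y ∈ P.ring) :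
    P.eval (x * y) = P.eval x * P.eval y := by
  rw [P.eval_eq_iff hP (mul_mem hx hy), map_mul]
  have : x * y - algebraMap K F (P.eval x) * algebraMap K F (P.eval y) =
    (x - algebraMap K F (P.eval x)) * y +
      algebraMap K F (P.eval x) * (y - algebraMap K F (P.eval y)) := by ring
  rw [this]
  refine P.val.map_add_lt ?_ ?_ <;> rw [map_mul]
  · exact mul_lt_one_of_lt_of_le (P.val_sub_eval_lt_one hP hx) (P.mem_ring_iff.1 hy)
  · exact (mul_le_of_le_one_left' (P.val_const_le _)).trans_lt (P.val_sub_eval_lt_one hP hy)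

/-- Evaluation at a rational place, as a homomorphism on its valuation ring. -/
noncomputable def evalHom (hP : P.IsRational) : P.ring →ₐ[K] K where
  toFun x := P.eval x
  map_one' := by
    have := P.eval_const hP 1
    rwa [map_one] at this
  map_mul' x y := P.eval_mul hP x.2 y.2
  map_zero' := by
    have := P.eval_const hP 0
    rwa [map_zero] at this
  map_add' x y := P.eval_add hP x.2 y.2
  commutes' a := P.eval_const hP a

theorem eval_eq_zero_iff {x : F} (hP : P.IsRational) (hx : x ∈ P.ring) :
    P.eval x = 0 ↔ P.val x < 1 := by
  rw [P.eval_eq_iff hP hx, map_zero, sub_zero]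

/-! ### Automorphisms acting on places -/

theorem mem_map_ring {σ : F ≃ₐ[K] F} {x : F} : x ∈ (P.map σ).ring ↔ σ.symm x ∈ P.ring := Iff.rfl

theorem val_map_lt_one {σ : F ≃ₐ[K] F} {x : F} :
    (P.map σ).val x < 1 ↔ P.val (σ.symm x) < 1 := by
  rw [← mem_nonunits_iff, ← mem_nonunits_iff, ValuationSubring.mem_nonunits_iff_or,
    ValuationSubring.mem_nonunits_iff_or, mem_map_ring, map_inv₀, map_eq_zero_iff _ σ.symm.injective]

theorem map_aut_mul (σ τ : F ≃ₐ[K] F) : P.map (σ * τ) = (P.map τ).map σ := Place.ext rfl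

theorem map_aut_one : P.map (1 : F ≃ₐ[K] F) = P := Place.ext rfl

section Galois

variable {G : Subgroup (F ≃ₐ[K] F)} {Q : Place K (IntermediateField.fixedField G)}

variable {P} in
theorem LiesOver.mem_iff {E : IntermediateField K F} {Q : Place K E} (h : P.LiesOver Q) (x : E) :
    x ∈ Q.ring ↔ (x : F) ∈ P.ring := by
  rw [LiesOver] at h
  rw [h]
  rfl

variable {P} in
theorem LiesOver.val_lt_one_iff {E : IntermediateField K F} {Q : Place K E} (h : P.LiesOver Q)
    (x : E) : Q.val x < 1 ↔ P.val (x : F) < 1 := by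
  rw [← mem_nonunits_iff, ← mem_nonunits_iff, ValuationSubring.mem_nonunits_iff_or,
    ValuationSubring.mem_nonunits_iff_or, h.mem_iff]
  simp

variable {P} in
theorem LiesOver.map (h : P.LiesOver Q) {σ : F ≃ₐ[K] F} (hσ : σ ∈ G) : (P.map σ).LiesOver Q := by
  have h' := h
  rw [LiesOver] at h' ⊢
  rw [h']
  ext x
  rw [ValuationSubring.mem_comap, ValuationSubring.mem_comap, mem_map_ring]
  have : σ.symm (algebraMap (IntermediateField.fixedField G) F x) =
      algebraMap (IntermediateField.fixedField G) F x :=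
    (IntermediateField.mem_fixedField_iff G _).1 x.2 σ⁻¹ (inv_mem hσ)
  rw [this]

theorem finrank_fixedField [Finite G] :
    Module.finrank (IntermediateField.fixedField G) F = Nat.card G := by
  have := Fintype.ofFinite G
  rw [Nat.card_eq_fintype_card]
  exact FixedPoints.finrank_eq_card G F

/-- The Galois group is transitive on the places over `Q`: otherwise the norm of a function that
is close to `1` on the orbit of `P` and small on the orbit of `P'` would be a unit at `P` and not
at `P'`, although it lies in the fixed field. -/
theorem exists_map_eq (hF : IsFunctionField K F) [Finite G] (hP : P.LiesOver Q)
    (hP' : P'.LiesOver Q) : ∃ σ ∈ G, P' = P.map σ := by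
  classical
  have := Fintype.ofFinite G
  by_contra! hcon
  obtain ⟨x, hxT, hxS⟩ := exists_approx_indicator hF
    (Finset.univ.image fun σ : G => P.map (σ : F ≃ₐ[K] F))
    (Finset.univ.image fun σ : G => P'.map (σ : F ≃ₐ[K] F)) (by
      rw [Finset.disjoint_left]
      intro R hR hR'
      simp only [Finset.mem_image, Finset.mem_univ, true_and] at hR hR'
      obtain ⟨σ, rfl⟩ := hR
      obtain ⟨τ, h⟩ := hR'
      refine hcon ((τ⁻¹ * σ : G) : F ≃ₐ[K] F) (τ⁻¹ * σ).2 ?_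
      rw [Subgroup.coe_mul, map_aut_mul, ← h, ← map_aut_mul, ← Subgroup.coe_mul, inv_mul_cancel,
        Subgroup.coe_one, map_aut_one])
  have hfix : (∏ σ : G, (σ : F ≃ₐ[K] F) x) ∈ IntermediateField.fixedField G := by
    rw [IntermediateField.mem_fixedField_iff]
    intro τ hτ
    rw [map_prod]
    exact Fintype.prod_equiv (Equiv.mulLeft (⟨τ, hτ⟩ : G)) _ _ fun σ => rfl
  have h1 : P.val (∏ σ : G, (σ : F ≃ₐ[K] F) x) = 1 := by
    rw [map_prod]
    refine Finset.prod_eq_one fun σ _ => ?_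
    have h : P.val ((σ : F ≃ₐ[K] F) x - 1) < 1 := by
      have := hxT (P.map ((σ⁻¹ : G) : F ≃ₐ[K] F)) (Finset.mem_image_of_mem _ (Finset.mem_univ _))
      rw [val_map_lt_one, map_sub, map_one] at this
      exact this
    rw [← sub_add_cancel ((σ : F ≃ₐ[K] F) x) 1, Valuation.map_add_eq_of_lt_right _ (by simpa using h),
      map_one]
  have h2 : P'.val (∏ σ : G, (σ : F ≃ₐ[K] F) x) < 1 := by
    have hlt : ∀ σ : G, P'.val ((σ : F ≃ₐ[K] F) x) < 1 := fun σ => by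
      have := hxS (P'.map ((σ⁻¹ : G) : F ≃ₐ[K] F)) (Finset.mem_image_of_mem _ (Finset.mem_univ _))
      rw [val_map_lt_one] at this
      exact this
    rw [map_prod, ← Finset.mul_prod_erase _ _ (Finset.mem_univ (1 : G))]
    exact mul_lt_one_of_lt_of_le (hlt 1) (Finset.prod_le_one' fun σ _ => (hlt σ).le)
  have h3 := (hP.val_lt_one_iff ⟨_, hfix⟩).1 ((hP'.val_lt_one_iff ⟨_, hfix⟩).2 h2)
  exact h3.ne h1

/-- Over a completely split place the Galois group acts freely, by counting. -/
theorem map_injOn (hF : IsFunctionField K F) [Finite G] (hP : P.LiesOver Q)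
    (hQ : Q.IsCompletelySplit) : Set.InjOn (fun σ : F ≃ₐ[K] F => P.map σ) G := by
  classical
  have := Fintype.ofFinite G
  have himg : (fun σ : F ≃ₐ[K] F => P.map σ) '' G = {P' : Place K F | P'.LiesOver Q} := by
    ext P'
    constructor
    · rintro ⟨σ, hσ, rfl⟩
      exact hP.map hσ
    · intro h
      obtain ⟨σ, hσ, rfl⟩ := P.exists_map_eq P' hF hP h
      exact ⟨σ, hσ, rfl⟩
  refine Set.injOn_of_ncard_image_eq ?_ (Set.toFinite _)
  rw [himg, hQ.2, finrank_fixedField]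
  rfl

/-- If `Q` is rational and completely split, every residue class at `P` contains the trace of a
function that is small at the other conjugates of `P`, hence a constant. -/
theorem isRational_of_isCompletelySplit (hF : IsFunctionField K F) [Finite G] (hP : P.LiesOver Q)
    (hQ : Q.IsCompletelySplit) (hQr : Q.IsRational) : P.IsRational := by
  classical
  have := Fintype.ofFinite G
  rw [isRational_iff] at hQr ⊢
  intro y hy
  set S : Finset (Place K F) := (Finset.univ.image fun σ : G => P.map (σ : F ≃ₐ[K] F)).erase P with hS
  obtain ⟨x, hx1, hx⟩ := exists_approx hF P S (by simp [hS])
  obtain ⟨N, hN⟩ : ∃ N : ℕ, ∀ R ∈ S, R.val (x ^ N * y) < 1 := by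
    have : ∀ R : Place K F, ∃ N : ℕ, R ∈ S → ∀ n ≥ N, R.val (x ^ n * y) < 1 := by
      intro R
      by_cases hR : R ∈ S
      · obtain ⟨N, hN⟩ := R.exists_pow_mul_lt_one hF (hx R hR) y
        exact ⟨N, fun _ => hN⟩
      · exact ⟨0, fun h => absurd h hR⟩
    choose N hN using this
    exact ⟨S.sup N, fun R hR => hN R hR _ (Finset.le_sup hR)⟩
  have hfix : (∑ σ : G, (σ : F ≃ₐ[K] F) (x ^ N * y)) ∈ IntermediateField.fixedField G := by
    rw [IntermediateField.mem_fixedField_iff]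
    intro τ hτ
    rw [map_sum]
    exact Fintype.sum_equiv (Equiv.mulLeft (⟨τ, hτ⟩ : G)) _ _ fun σ => rfl
  have hpow : P.val (x ^ N * y - y) < 1 := by
    rw [← sub_one_mul, map_mul]
    refine mul_lt_one_of_lt_of_le ?_ (P.mem_ring_iff.1 hy)
    have hxr : x ∈ P.ring := by
      rw [← sub_add_cancel x 1]
      exact add_mem (P.mem_ring_iff.2 hx1.le) (one_mem _)
    rw [← mul_geom_sum, map_mul]
    refine mul_lt_one_of_lt_of_le hx1 (P.mem_ring_iff.1 (sum_mem fun i _ => pow_mem hxr i))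
  have htr : P.val (∑ σ : G, (σ : F ≃ₐ[K] F) (x ^ N * y) - y) < 1 := by
    rw [← Finset.add_sum_erase _ _ (Finset.mem_univ (1 : G)), add_sub_right_comm]
    refine P.val.map_add_lt hpow (P.val.map_sum_lt one_ne_zero fun σ hσ => ?_)
    have := hN (P.map ((σ⁻¹ : G) : F ≃ₐ[K] F)) (by
      rw [hS, Finset.mem_erase]
      refine ⟨fun h => ?_, Finset.mem_image_of_mem _ (Finset.mem_univ _)⟩
      have h1 : ((σ⁻¹ : G) : F ≃ₐ[K] F) = 1 := P.map_injOn hF hP hQ (σ⁻¹).2 (one_mem G)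
        (h.trans P.map_aut_one.symm)
      exact Finset.ne_of_mem_erase hσ (inv_eq_one.1 (Subtype.ext h1)))
    rw [val_map_lt_one] at this
    exact this
  have hmem : (∑ σ : G, (σ : F ≃ₐ[K] F) (x ^ N * y)) ∈ P.ring := by
    rw [← sub_add_cancel (∑ σ : G, (σ : F ≃ₐ[K] F) (x ^ N * y)) y]
    exact add_mem (P.mem_ring_iff.2 htr.le) hy
  obtain ⟨a, ha⟩ := hQr ⟨_, hfix⟩ ((hP.mem_iff ⟨_, hfix⟩).2 hmem)
  refine ⟨a, ?_⟩
  have ha' := (hP.val_lt_one_iff _).1 ha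
  have : y - algebraMap K F a = (∑ σ : G, (σ : F ≃ₐ[K] F) (x ^ N * y) - algebraMap K F a) -
    (∑ σ : G, (σ : F ≃ₐ[K] F) (x ^ N * y) - y) := by ring
  rw [this]
  exact P.val.map_sub_lt ha' htr

end Galois

/-! ### Totally ramified places -/

theorem ord_eq_of_val_eq (hF : IsFunctionField K F) {t : F} (ht : P.IsUniformizer t) {k : ℤ} {x : F}
    (h : P.val x = P.val t ^ k) : P.ord x = k := by
  have h1 : (k : WithTop ℤ) ≤ P.ord x := (P.le_ord_iff hF ht k x).2 h.le
  have h2 : ¬ ((k + 1 : ℤ) : WithTop ℤ) ≤ P.ord x := by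
    rw [P.le_ord_iff hF ht, h, ht.zpow_le_zpow_iff]
    omega
  generalize P.ord x = o at h1 h2
  cases o with
  | top => exact absurd le_top h2
  | coe m =>
    rw [WithTop.coe_le_coe] at h1 h2
    exact congrArg _ (by omega)

section TotallyRamified

variable {E : IntermediateField K F}

variable {P} in
theorem IsTotallyRamified.val_eq (hF : IsFunctionField K F) {t : F} (ht : P.IsUniformizer t)
    (hn : 0 < Module.finrank E F) (h : P.IsTotallyRamified E) (x : E) (hx : x ≠ 0) :
    ∃ j : ℤ, P.val (x : F) = P.val t ^ (Module.finrank E F * j) := by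
  obtain ⟨Q, -, hQ⟩ := h
  obtain ⟨k, hk⟩ := ht.2 (x : F) (by simpa using hx)
  have h1 := (P.ord_eq_of_val_eq hF ht hk).symm.trans (hQ x)
  generalize Q.ord x = o at h1
  cases o with
  | top =>
    obtain ⟨n, hn'⟩ := Nat.exists_eq_succ_of_ne_zero hn.ne'
    rw [hn', succ_nsmul] at h1
    simp at h1
  | coe j =>
    rw [← WithTop.coe_nsmul, WithTop.coe_inj, nsmul_eq_mul] at h1
    exact ⟨j, by rw [hk, h1]⟩

variable {P} in
/-- In `∑ a_i t ^ i` with `a_i ∈ E` and `i < [F : E]` the terms have pairwise distinct orders, so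
none of them has a larger value than the sum. -/
theorem IsTotallyRamified.val_term_le (hF : IsFunctionField K F) {t : F} (ht : P.IsUniformizer t)
    (h : P.IsTotallyRamified E) (a : Fin (Module.finrank E F) → E) (i : Fin (Module.finrank E F)) :
    P.val ((a i : F) * t ^ (i : ℕ)) ≤ P.val (∑ j, (a j : F) * t ^ (j : ℕ)) := by
  classical
  have hn : 0 < Module.finrank E F := i.pos
  obtain ⟨m, -, hm⟩ := Finset.exists_max_image Finset.univ
    (fun j => P.val ((a j : F) * t ^ (j : ℕ))) ⟨i, Finset.mem_univ i⟩
  refine (hm i (Finset.mem_univ i)).trans ?_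
  rcases eq_or_ne (a m) 0 with h0 | h0
  · simp [h0]
  have hpos : 0 < P.val ((a m : F) * t ^ (m : ℕ)) :=
    P.val_pos (mul_ne_zero (by simpa using h0) (pow_ne_zero _ ht.ne_zero))
  have hlt : ∀ j ∈ Finset.univ.erase m,
      P.val ((a j : F) * t ^ (j : ℕ)) < P.val ((a m : F) * t ^ (m : ℕ)) := by
    intro j hj
    refine lt_of_le_of_ne (hm j (Finset.mem_univ j)) fun heq => Finset.ne_of_mem_erase hj ?_
    rcases eq_or_ne (a j) 0 with hj0 | hj0
    · rw [hj0, ZeroMemClass.coe_zero, zero_mul, map_zero] at heq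
      exact absurd heq hpos.ne
    obtain ⟨k, hk⟩ := h.val_eq hF ht hn (a j) hj0
    obtain ⟨l, hl⟩ := h.val_eq hF ht hn (a m) h0
    rw [map_mul, map_mul, map_pow, map_pow, hk, hl, ← zpow_natCast, ← zpow_natCast,
      ← zpow_add₀ ht.val_pos.ne', ← zpow_add₀ ht.val_pos.ne'] at heq
    have h1 := le_antisymm (ht.zpow_le_zpow_iff.1 heq.ge) (ht.zpow_le_zpow_iff.1 heq.le)
    have h2 := congrArg (· % (Module.finrank E F : ℤ)) h1
    simp only [Int.mul_add_emod_self_left] at h2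
    rw [Int.emod_eq_of_lt (by positivity) (by exact_mod_cast j.2),
      Int.emod_eq_of_lt (by positivity) (by exact_mod_cast m.2)] at h2
    exact Fin.ext (by exact_mod_cast h2)
  rw [← Finset.add_sum_erase _ _ (Finset.mem_univ m),
    Valuation.map_add_eq_of_lt_left _ (P.val.map_sum_lt hpos.ne' hlt)]

variable {P} in
theorem IsTotallyRamified.exists_expansion (hF : IsFunctionField K F) {t : F}
    (ht : P.IsUniformizer t) (hn : 0 < Module.finrank E F) (h : P.IsTotallyRamified E) (x : F) :
    ∃ a : Fin (Module.finrank E F) → E, x = ∑ j, (a j : F) * t ^ (j : ℕ) := by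
  have hli : LinearIndependent E fun j : Fin (Module.finrank E F) => t ^ (j : ℕ) := by
    rw [Fintype.linearIndependent_iff]
    intro a ha i
    have := h.val_term_le hF ht a i
    rw [show ∑ j, (a j : F) * t ^ (j : ℕ) = 0 from ha, map_zero, le_zero_iff, P.val.zero_iff] at this
    exact Subtype.ext ((mul_eq_zero.1 this).resolve_right (pow_ne_zero _ ht.ne_zero))
  have hne : Nonempty (Fin (Module.finrank E F)) := ⟨⟨0, hn⟩⟩
  have hspan := hli.span_eq_top_of_card_eq_finrank (by simp)
  obtain ⟨a, ha⟩ := (Submodule.mem_span_range_iff_exists_fun E).1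
    (hspan ▸ Submodule.mem_top : x ∈ Submodule.span E _)
  exact ⟨a, ha.symm⟩

variable {P} in
/-- A totally ramified place is the only place over its restriction to `E`, since its valuation
ring is generated by a uniformizer `t` over that of the restriction, and `t` satisfies a monic
equation. -/
theorem IsTotallyRamified.eq_of_forall_mem (hF : IsFunctionField K F)
    (hn : 0 < Module.finrank E F) (h : P.IsTotallyRamified E)
    (hle : ∀ x : E, (x : F) ∈ P.ring → (x : F) ∈ P'.ring) : P' = P := by
  obtain ⟨t, ht⟩ := P.exists_isUniformizer hF
  have hcoeff : ∀ (a : Fin (Module.finrank E F) → E), ∑ j, (a j : F) * t ^ (j : ℕ) ∈ P.ring →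
      ∀ i, (a i : F) ∈ P'.ring := by
    intro a ha i
    refine hle _ ?_
    rcases eq_or_ne (a i) 0 with h0 | h0
    · rw [h0]; exact zero_mem _
    have h1 := (h.val_term_le hF ht a i).trans (P.mem_ring_iff.1 ha)
    obtain ⟨j, hj⟩ := h.val_eq hF ht hn (a i) h0
    rw [map_mul, map_pow, hj, ← zpow_natCast, ← zpow_add₀ ht.val_pos.ne', ← zpow_zero (P.val t),
      ht.zpow_le_zpow_iff] at h1
    rw [mem_ring_iff, hj, ← zpow_zero (P.val t), ht.zpow_le_zpow_iff]
    have hi : ((i : ℕ) : ℤ) < Module.finrank E F := by exact_mod_cast i.2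
    have : -1 < j := by
      by_contra hcon
      have : (Module.finrank E F : ℤ) * j ≤ Module.finrank E F * (-1) :=
        mul_le_mul_of_nonneg_left (by omega) (by positivity)
      omega
    exact mul_nonneg (by positivity) (by omega)
  have htP' : t ∈ P'.ring := by
    obtain ⟨a, ha⟩ := h.exists_expansion hF ht hn (t ^ Module.finrank E F)
    have hmem := hcoeff a (ha ▸ pow_mem (P.mem_ring_iff.2 ht.1.le) _)
    by_contra hcon
    rw [mem_ring_iff, not_le] at hcon
    have hlt : P'.val (∑ j, (a j : F) * t ^ (j : ℕ)) < P'.val t ^ Module.finrank E F := by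
      refine P'.val.map_sum_lt (pow_ne_zero _ (zero_lt_one.trans hcon).ne') fun i _ => ?_
      rw [map_mul, map_pow]
      exact (mul_le_of_le_one_left' (P'.mem_ring_iff.1 (hmem i))).trans_lt
        (pow_lt_pow_right₀ hcon i.2)
    rw [← ha, map_pow] at hlt
    exact lt_irrefl _ hlt
  refine (P.eq_of_ring_le P' hF fun x hx => ?_).symm
  obtain ⟨a, rfl⟩ := h.exists_expansion hF ht hn x
  exact sum_mem fun i _ => mul_mem (hcoeff a hx i) (pow_mem htP' _)

/-- The restriction of a place to a subfield over which `F` is finite. -/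
def restrict (E : IntermediateField K F) [FiniteDimensional E F] : Place K E where
  ring := P.ring.comap (algebraMap E F)
  const_mem a := P.const_mem a
  ne_top h := by
    refine P.ne_top (eq_top_iff.2 fun x _ => ?_)
    refine mem_of_isIntegral P.ring (S := E) (fun s => ?_) (Algebra.IsIntegral.isIntegral x)
    have : s ∈ P.ring.comap (algebraMap E F) := h ▸ ValuationSubring.mem_top s
    exact this

end TotallyRamified

end Place

namespace Place

variable {K F : Type*} [Field K] [Field F] [Algebra K F] (P₀ : Place K F)

/-! ### Functions with poles only at one rational place -/

theorem isAlgebraic_of_forall_mem {u : F} (hu : ∀ P : Place K F, u ∈ P.ring) : IsAlgebraic K u := by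
  have hmem : u ∈ (⨅ V : {V : ValuationSubring F // Set.range (algebraMap K F) ⊆ V.toSubring},
      V.1.toSubring) := by
    rw [Subring.mem_iInf]
    rintro ⟨V, hV⟩
    by_cases htop : V = ⊤
    · subst htop; exact ValuationSubring.mem_top u
    · exact hu ⟨V, fun a => hV ⟨a, rfl⟩, htop⟩
  rw [iInf_valuationSubring_superset] at hmem
  have hint : IsIntegral (Subring.closure (Set.range (algebraMap K F))) u := hmem
  obtain ⟨p, hp, hpu⟩ := hint
  have hcl : Subring.closure (Set.range (algebraMap K F)) = (algebraMap K F).range := by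
    rw [← RingHom.coe_range, Subring.closure_eq]
  have hlift : p.map (Subring.subtype _) ∈ Polynomial.lifts (algebraMap K F) := by
    rw [Polynomial.lifts_iff_coeff_lifts]
    intro n
    rw [Polynomial.coeff_map]
    exact (SetLike.ext_iff.1 hcl _).1 (p.coeff n).2
  obtain ⟨q, hq, -, hqm⟩ := Polynomial.lifts_and_natDegree_eq_and_monic hlift (hp.map _)
  refine IsIntegral.isAlgebraic ⟨q, hqm, ?_⟩
  rw [← Polynomial.eval_map, hq, Polynomial.eval_map]
  exact hpu

theorem eq_zero_of_forall_mem {u : F} (hu : ∀ P : Place K F, P ≠ P₀ → u ∈ P.ring)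
    (h : P₀.val u < 1) : u = 0 := by
  by_contra h0
  refine P₀.transcendental_of_val_lt_one h0 h (isAlgebraic_of_forall_mem fun P => ?_)
  rcases eq_or_ne P P₀ with rfl | hP
  · exact P.mem_ring_iff.2 h.le
  · exact hu P hP

/-- The functions that are regular away from `P₀` and have a pole of order less than `n` at `P₀`,
where `t` is a uniformizer at `P₀`; this is `ℒ((n - 1) P₀)`. -/
def poleSpace (t : F) (n : ℕ) : Submodule K F where
  carrier := {f | (∀ P : Place K F, P ≠ P₀ → f ∈ P.ring) ∧ P₀.val (f * t ^ n) < 1}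
  zero_mem' := ⟨fun _ _ => zero_mem _, by simp⟩
  add_mem' := by
    rintro f g ⟨hf, hf'⟩ ⟨hg, hg'⟩
    refine ⟨fun P hP => add_mem (hf P hP) (hg P hP), ?_⟩
    rw [add_mul]
    exact P₀.val.map_add_lt hf' hg'
  smul_mem' := by
    rintro c f ⟨hf, hf'⟩
    rw [Algebra.smul_def]
    refine ⟨fun P hP => mul_mem (P.const_mem c) (hf P hP), ?_⟩
    rw [mul_assoc, map_mul]
    exact (mul_le_of_le_one_left' (P₀.val_const_le c)).trans_lt hf'

variable {P₀}

theorem IsUniformizer.mem_ring_of_mul_lt_one {t : F} (ht : P₀.IsUniformizer t) {x : F}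
    (h : P₀.val (x * t) < 1) : x ∈ P₀.ring := by
  rcases eq_or_ne x 0 with rfl | hx
  · exact zero_mem _
  obtain ⟨k, hk⟩ := ht.2 x hx
  rw [mem_ring_iff, hk, ← zpow_zero (P₀.val t), ht.zpow_le_zpow_iff]
  rw [map_mul, hk, ← zpow_add_one₀ ht.val_pos.ne', ← zpow_zero (P₀.val t), ← not_le,
    ht.zpow_le_zpow_iff] at h
  omega

/-- The leading coefficient of a function at its pole, relative to a uniformizer. -/
noncomputable def leadingCoeff (hP₀ : P₀.IsRational) {t : F} (ht : P₀.IsUniformizer t) (n : ℕ) :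
    P₀.poleSpace t (n + 1) →ₗ[K] K where
  toFun f := P₀.eval ((f : F) * t ^ n)
  map_add' f g := by
    have hmem : ∀ f : P₀.poleSpace t (n + 1), (f : F) * t ^ n ∈ P₀.ring := fun f =>
      ht.mem_ring_of_mul_lt_one (by rw [mul_assoc, ← pow_succ]; exact f.2.2)
    rw [Submodule.coe_add, add_mul, P₀.eval_add hP₀ (hmem f) (hmem g)]
  map_smul' c f := by
    have hmem : (f : F) * t ^ n ∈ P₀.ring :=
      ht.mem_ring_of_mul_lt_one (by rw [mul_assoc, ← pow_succ]; exact f.2.2)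
    rw [Submodule.coe_smul, Algebra.smul_def, mul_assoc, P₀.eval_mul hP₀ (P₀.const_mem c) hmem,
      P₀.eval_const hP₀]
    rfl

theorem rank_poleSpace_le (hP₀ : P₀.IsRational) {t : F} (ht : P₀.IsUniformizer t) (n : ℕ) :
    Module.rank K (P₀.poleSpace t n) ≤ n := by
  induction n with
  | zero =>
    have : P₀.poleSpace t 0 = ⊥ := by
      rw [eq_bot_iff]
      rintro u ⟨hu, h⟩
      rw [pow_zero, mul_one] at h
      exact P₀.eq_zero_of_forall_mem hu h
    rw [this]
    simp
  | succ n ih =>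
    set φ := leadingCoeff hP₀ ht n with hφ
    have hker : Module.rank K (LinearMap.ker φ) ≤ n := by
      refine le_trans (LinearMap.rank_le_of_injective
        (((P₀.poleSpace t (n + 1)).subtype ∘ₗ (LinearMap.ker φ).subtype).codRestrict
          (P₀.poleSpace t n) ?_) ?_) ih
      · rintro ⟨f, hf⟩
        refine ⟨f.2.1, (P₀.eval_eq_zero_iff hP₀ ?_).1 hf⟩
        exact ht.mem_ring_of_mul_lt_one (by rw [mul_assoc, ← pow_succ]; exact f.2.2)
      · intro f g hfg
        exact Subtype.ext (Subtype.ext (congrArg (fun h : P₀.poleSpace t n => (h : F)) hfg))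
    have hrange : Module.rank K (LinearMap.range φ) ≤ 1 :=
      (Submodule.rank_le _).trans (Module.rank_self K).le
    have h := LinearMap.lift_rank_range_add_rank_ker φ
    rw [← Cardinal.lift_le.{_, _}, ← h]
    calc _ ≤ Cardinal.lift (1 : Cardinal) + Cardinal.lift (n : Cardinal) :=
          add_le_add (Cardinal.lift_le.2 hrange) (Cardinal.lift_le.2 hker)
      _ = _ := by simp [add_comm]

/-- A function `f` whose only pole is `P₀`, of order at most `k`, has at most `k` zeros.
Functions approximating the indicators of the `ℓ` zeros of `f` are linearly independent over
`K(f)`, and may be scaled so as to have no pole away from `P₀`; multiplying them by the powers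
`f ^ j` with `j ≤ N` gives `(N + 1) ℓ` linearly independent functions with poles of order
`N k + O(1)` at `P₀`, whence `ℓ ≤ k`. -/
theorem card_zeros_le (hF : IsFunctionField K F) (hP₀ : P₀.IsRational) {t : F}
    (ht : P₀.IsUniformizer t) {f : F} (hf0 : f ≠ 0) (hf : ∀ P : Place K F, P ≠ P₀ → f ∈ P.ring)
    {k : ℕ} (hk : P₀.val (f * t ^ k) ≤ 1) (S : Finset (Place K F)) (hS : ∀ P ∈ S, P.val f < 1) :
    S.card ≤ k := by
  classical
  rcases S.eq_empty_or_nonempty with rfl | ⟨P₁, hP₁⟩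
  · simp
  have htr : Transcendental K f := P₁.transcendental_of_val_lt_one hf0 (hS P₁ hP₁)
  have := hF.isAlgebraic_adjoin htr
  have : ∀ P : Place K F, ∃ x : F, P.val (x - 1) < 1 ∧ ∀ R ∈ S.erase P, R.val x < 1 :=
    fun P => exists_approx hF P _ (by simp)
  choose x hx1 hx using this
  have hx1' : ∀ P : Place K F, P.val (x P) = 1 := fun P : Place K F => by
    rw [← sub_add_cancel (x P) 1, Valuation.map_add_eq_of_lt_right _ (by simpa using hx1 P), map_one]
  have hind : ∀ φ : S → Polynomial K, ∑ P, Polynomial.aeval f (φ P) * x P = 0 → ∀ P, φ P = 0 := by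
    refine eq_zero_of_forall_X_dvd hf0 fun φ hφ P => ?_
    rw [Polynomial.X_dvd_iff]
    by_contra hcon
    have hone := P.1.val_aeval_eq_one (hS P P.2) hcon
    rw [← Finset.add_sum_erase _ _ (Finset.mem_univ P), ← eq_neg_iff_add_eq_zero] at hφ
    have hlt : P.1.val (∑ R ∈ Finset.univ.erase P, Polynomial.aeval f (φ R) * x R) < 1 := by
      refine P.1.val.map_sum_lt one_ne_zero fun R hR => ?_
      rw [map_mul]
      refine (mul_le_of_le_one_left' (P.1.val_aeval_le (hS P P.2).le _)).trans_lt (hx R P ?_)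
      exact Finset.mem_erase.2 ⟨fun h => Finset.ne_of_mem_erase hR (Subtype.ext h.symm), P.2⟩
    rw [← Valuation.map_neg, ← hφ, map_mul, hone, hx1', one_mul] at hlt
    exact lt_irrefl _ hlt
  -- scale by a common denominator
  obtain ⟨y, hy0, hy⟩ :=
    Algebra.IsAlgebraic.exists_integral_multiples (Algebra.adjoin K {f}) (S.image x)
  set g : S → F := fun P => y * x P with hg
  have hgmem : ∀ P : S, ∀ R : Place K F, R ≠ P₀ → g P ∈ R.ring := by
    intro P R hR
    refine mem_of_isIntegral (S := Algebra.adjoin K {f}) R.ring (fun s => ?_)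
      (hy _ (Finset.mem_image_of_mem x P.2))
    obtain ⟨φ, hφ⟩ := (SetLike.ext_iff.1 (Algebra.adjoin_singleton_eq_range_aeval K f) _).1 s.2
    change (s : F) ∈ R.ring
    rw [← hφ, R.mem_ring_iff]
    exact R.val_aeval_le (R.mem_ring_iff.1 (hf R hR)) φ
  have hgind : ∀ φ : S → Polynomial K, ∑ P, Polynomial.aeval f (φ P) * g P = 0 → ∀ P, φ P = 0 := by
    intro φ hφ
    refine hind φ ((mul_eq_zero.1 (?_ : (y : F) * _ = 0)).resolve_left (by simpa using hy0))
    rw [Finset.mul_sum, ← hφ]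
    exact Finset.sum_congr rfl fun P _ => by rw [hg]; ring
  obtain ⟨c, hc⟩ : ∃ c : ℕ, ∀ P : S, P₀.val (g P * t ^ c) < 1 := by
    choose N hN using fun P : S => P₀.exists_pow_mul_lt_one hF ht.1 (g P)
    refine ⟨Finset.univ.sup N, fun P => ?_⟩
    rw [mul_comm]
    exact hN P _ (Finset.le_sup (Finset.mem_univ P))
  have hmem : ∀ p : Fin (c + 1) × S, f ^ (p.1 : ℕ) * g p.2 ∈ P₀.poleSpace t (c + k * c) := by
    rintro ⟨j, P⟩
    refine ⟨fun R hR => mul_mem (pow_mem (hf R hR) _) (hgmem P R hR), ?_⟩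
    obtain ⟨i, hi⟩ := Nat.exists_eq_add_of_le (Nat.lt_succ_iff.1 j.2)
    have heq : f ^ (j : ℕ) * g P * t ^ (c + k * c) =
        (f * t ^ k) ^ (j : ℕ) * t ^ (k * i) * (g P * t ^ c) := by
      have : t ^ (k * c) = t ^ (k * j) * t ^ (k * i) := by rw [← pow_add, ← mul_add, ← hi]
      rw [pow_add, this, mul_pow, ← pow_mul]
      ring
    change P₀.val (f ^ (j : ℕ) * g P * t ^ (c + k * c)) < 1
    rw [heq, map_mul]
    refine (mul_le_of_le_one_left' ?_).trans_lt (hc P)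
    rw [← P₀.mem_ring_iff] at hk ⊢
    exact mul_mem (pow_mem hk _) (pow_mem (P₀.mem_ring_iff.2 ht.1.le) _)
  have hli : LinearIndependent K (fun p : Fin (c + 1) × S => f ^ (p.1 : ℕ) * g p.2) := by
    rw [Fintype.linearIndependent_iff]
    intro a ha
    have h := hgind (fun P => ∑ j : Fin (c + 1), Polynomial.monomial (j : ℕ) (a (j, P))) (by
      rw [← ha, Fintype.sum_prod_type_right]
      refine Finset.sum_congr rfl fun P _ => ?_
      rw [map_sum, Finset.sum_mul]
      refine Finset.sum_congr rfl fun j _ => ?_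
      rw [Polynomial.aeval_monomial, Algebra.smul_def, mul_assoc])
    rintro ⟨j, P⟩
    have hj := congrArg (fun p => Polynomial.coeff p (j : ℕ)) (h P)
    simpa [Polynomial.finsetSum_coeff, Polynomial.coeff_monomial, Fin.val_inj] using hj
  have hli' : LinearIndependent K
      (fun p : Fin (c + 1) × S => (⟨_, hmem p⟩ : P₀.poleSpace t (c + k * c))) :=
    LinearIndependent.of_comp (P₀.poleSpace t (c + k * c)).subtype hli
  have hcard := hli'.cardinal_lift_le_rank.trans
    (Cardinal.lift_le.2 (rank_poleSpace_le hP₀ ht (c + k * c)))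
  simp only [Cardinal.mk_fintype, Fintype.card_prod, Fintype.card_fin, Fintype.card_coe,
    Cardinal.lift_natCast, Nat.cast_le] at hcard
  nlinarith

end Place

/-! ### Internal direct products -/

theorem IsInternalDirectProduct.card_eq {A ι : Type*} [Group A] [Fintype ι] {H : ι → Subgroup A}
    {G : Subgroup A} (h : IsInternalDirectProduct H G) : Nat.card G = ∏ i, Nat.card (H i) := by
  obtain ⟨hcomm, hind, rfl⟩ := h
  have hc : Pairwise fun i j : ι => ∀ x y : A, x ∈ H i → y ∈ H j → Commute x y :=
    fun i j hij x y hx hy => hcomm i j hij x hx y hy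
  rw [← Nat.card_pi, ← Subgroup.noncommPiCoprod_range (hcomm := hc)]
  exact (Nat.card_congr (MonoidHom.ofInjective
    (Subgroup.injective_noncommPiCoprod_of_iSupIndep hind)).toEquiv).symm

theorem IsInternalDirectProduct.le {A ι : Type*} [Group A] {H : ι → Subgroup A}
    {G : Subgroup A} (h : IsInternalDirectProduct H G) (i : ι) : H i ≤ G :=
  h.2.2 ▸ le_iSup H i

theorem IsInternalDirectProduct.eq_one {A ι : Type*} [Group A] {H : ι → Subgroup A}
    {G : Subgroup A} (h : IsInternalDirectProduct H G) {i j : ι} (hij : i ≠ j) {x : A}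
    (hi : x ∈ H i) (hj : x ∈ H j) : x = 1 :=
  Subgroup.disjoint_def.1 (h.2.1.pairwiseDisjoint hij) hi hj

/-! ### Linear codes with a recovery rule -/

section Codes

variable {K : Type*} [Field K] {n s : ℕ}

/-- If every codeword satisfies the linear recovery rules `x a = ∑ b ∈ R i, c b * x b`, so do the
columns of any generator matrix. -/
theorem isLocallyRecoverable_of_forall {C : Submodule K (Fin n → K)} {d : ℕ} {r : Fin s → ℕ}
    (hd : d ≤ minDist C) (R : Fin n → Fin s → Finset (Fin n))
    (hdisj : ∀ a i j, i ≠ j → Disjoint (R a i) (R a j)) (hmem : ∀ a i, a ∉ R a i)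
    (hcard : ∀ a i, (R a i).card = r i)
    (hrec : ∀ a i, ∃ c : Fin n → K, ∀ x ∈ C, x a = ∑ b ∈ R a i, c b * x b) :
    IsLocallyRecoverable C (Module.finrank K C) d r := by
  refine ⟨rfl, hd, ?_⟩
  set b := Module.finBasis K C
  refine ⟨Matrix.of fun i => (b i : Fin n → K), ⟨?_, ?_⟩, fun a => ⟨R a, hdisj a, fun i =>
    ⟨hmem a i, hcard a i, ?_⟩⟩⟩
  · exact b.linearIndependent.map' C.subtype (Submodule.ker_subtype C)
  · have h := congrArg (Submodule.map C.subtype) b.span_eq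
    rw [Submodule.map_span, Submodule.map_top, Submodule.range_subtype, ← Set.range_comp] at h
    exact h
  · obtain ⟨c, hc⟩ := hrec a i
    have : (Matrix.of fun i => (b i : Fin n → K)).col a =
        ∑ j ∈ R a i, c j • (Matrix.of fun i => (b i : Fin n → K)).col j := by
      ext l
      rw [Finset.sum_apply]
      exact hc _ (b l).2
    rw [this]
    exact Submodule.sum_mem _ fun j hj =>
      Submodule.smul_mem _ _ (Submodule.subset_span ⟨j, hj, rfl⟩)

theorem le_minDist {C : Submodule K (Fin n → K)} {d : ℕ} (hC : C ≠ ⊥)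
    (h : ∀ x ∈ C, x ≠ 0 → ∀ Z : Finset (Fin n), (∀ a ∈ Z, x a = 0) → Z.card + d ≤ n) :
    d ≤ minDist C := by
  classical
  obtain ⟨x, hx, hx0⟩ := C.exists_mem_ne_zero_of_ne_bot hC
  refine le_csInf ⟨_, x, hx, 0, C.zero_mem, hx0, rfl⟩ ?_
  rintro _ ⟨x, hx, y, hy, hxy, rfl⟩
  have h1 := h (x - y) (C.sub_mem hx hy) (sub_ne_zero.2 hxy)
    (Finset.univ.filter fun a => x a = y a) (fun a ha => by
      rw [Pi.sub_apply, (Finset.mem_filter.1 ha).2, sub_self])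
  have h2 := Finset.card_filter_add_card_filter_not (s := (Finset.univ : Finset (Fin n)))
    (fun a => x a = y a)
  rw [Finset.card_univ, Fintype.card_fin] at h2
  have h3 : hammingDist x y = (Finset.univ.filter fun a => ¬ x a = y a).card := by
    unfold hammingDist
    congr 1
  have h4 : d ≤ hammingDist x y := by omega
  convert h4

end Codes

namespace Place

variable {K F : Type*} [Field K] [Field F] [Algebra K F]

/-! ### Evaluation of the code functions on an orbit -/

theorem eval_map {P : Place K F} {σ : F ≃ₐ[K] F} (hP : P.IsRational) (hP' : (P.map σ).IsRational)
    {x : F} (hx : σ.symm x ∈ P.ring) : (P.map σ).eval x = P.eval (σ.symm x) := by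
  rw [eval_eq_iff _ hP' hx, val_map_lt_one, map_sub, AlgEquiv.commutes]
  exact P.val_sub_eval_lt_one hP hx

/-- On places where `z` takes a fixed value `c`, a function of the code space is a polynomial of
degree less than `r` in `w`. -/
theorem exists_polynomial_of_mem_codeSpace {r t : ℕ} {z w f : F} (hf : f ∈ codeSpace K r t z w)
    (c : K) : ∃ h : Polynomial K, h.degree < r ∧ ∀ P : Place K F, P.IsRational → z ∈ P.ring →
      w ∈ P.ring → P.eval z = c → P.eval f = h.eval (P.eval w) := by
  obtain ⟨a, rfl⟩ := hf
  refine ⟨∑ l ∈ Finset.range r,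
    Polynomial.C (∑ j ∈ Finset.range (t + 1), a l j * c ^ j) * Polynomial.X ^ l, ?_, ?_⟩
  · rw [← Polynomial.mem_degreeLT]
    refine Submodule.sum_mem _ fun l hl => Polynomial.mem_degreeLT.2 ?_
    exact (Polynomial.degree_C_mul_X_pow_le _ _).trans_lt
      (by exact_mod_cast Finset.mem_range.1 hl)
  · intro P hP hz hw hc
    set z' : P.ring := ⟨z, hz⟩
    set w' : P.ring := ⟨w, hw⟩
    have h : P.evalHom hP (∑ l ∈ Finset.range r,
        (∑ j ∈ Finset.range (t + 1), algebraMap K P.ring (a l j) * z' ^ j) * w' ^ l) =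
        ∑ l ∈ Finset.range r, (∑ j ∈ Finset.range (t + 1), a l j * c ^ j) * P.eval w ^ l := by
      have hz' : P.evalHom hP z' = c := hc
      have hw' : P.evalHom hP w' = P.eval w := rfl
      simp only [map_sum, map_mul, map_pow, AlgHom.commutes, Algebra.algebraMap_self,
        RingHom.id_apply, hz', hw']
    rw [Polynomial.eval_finsetSum]
    simp only [Polynomial.eval_mul, Polynomial.eval_C, Polynomial.eval_pow, Polynomial.eval_X]
    rw [← h]
    change _ = P.eval _
    push_cast
    rfl

theorem ncard_orbit {P : Place K F} {H : Subgroup (F ≃ₐ[K] F)}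
    (h : Set.InjOn (fun σ : F ≃ₐ[K] F => P.map σ) H) : (P.orbit H).ncard = Nat.card H := by
  have : P.orbit H = (fun σ : F ≃ₐ[K] F => P.map σ) '' H := by
    ext P'
    exact ⟨fun ⟨σ, hσ, he⟩ => ⟨σ, hσ, he.symm⟩, fun ⟨σ, hσ, he⟩ => ⟨σ, hσ, he.symm⟩⟩
  rw [this, h.ncard_image]
  rfl

theorem mem_orbit_self (P : Place K F) (H : Subgroup (F ≃ₐ[K] F)) : P ∈ P.orbit H :=
  ⟨1, one_mem H, P.map_aut_one.symm⟩

end Place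

section Construction

variable {K F : Type*} [Field K] [Field F] [Algebra K F] {n : ℕ}

theorem mem_repairSet {P : Fin n → Place K F} {H : Subgroup (F ≃ₐ[K] F)} {a b : Fin n} :
    b ∈ repairSet P H a ↔ b ≠ a ∧ P b ∈ (P a).orbit H := by
  simp [repairSet]

theorem card_repairSet {P : Fin n → Place K F} (hP : Function.Injective P)
    {H : Subgroup (F ≃ₐ[K] F)} {a : Fin n} (hinj : Set.InjOn (fun σ : F ≃ₐ[K] F => (P a).map σ) H)
    (hsub : (P a).orbit H ⊆ Set.range P) : (repairSet P H a).card + 1 = Nat.card H := by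
  classical
  have hins : P '' (insert a (repairSet P H a) : Finset (Fin n)) = (P a).orbit H := by
    ext Q
    constructor
    · rintro ⟨b, hb, rfl⟩
      rcases Finset.mem_insert.1 hb with rfl | hb
      · exact (P b).mem_orbit_self H
      · exact (mem_repairSet.1 hb).2
    · intro hQ
      obtain ⟨b, rfl⟩ := hsub hQ
      refine ⟨b, Finset.mem_insert.2 ?_, rfl⟩
      rcases eq_or_ne b a with h | h
      · exact Or.inl h
      · exact Or.inr (mem_repairSet.2 ⟨h, hQ⟩)
  rw [← Place.ncard_orbit hinj, ← hins, Set.ncard_image_of_injective _ hP, Set.ncard_coe_finset,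
    Finset.card_insert_of_notMem fun h => (mem_repairSet.1 h).1 rfl]

theorem disjoint_repairSet {P : Fin n → Place K F} (hP : Function.Injective P)
    {H H' G : Subgroup (F ≃ₐ[K] F)} (hH : H ≤ G) (hH' : H' ≤ G)
    (hone : ∀ σ, σ ∈ H → σ ∈ H' → σ = 1) {a : Fin n}
    (hinj : Set.InjOn (fun σ : F ≃ₐ[K] F => (P a).map σ) G) :
    Disjoint (repairSet P H a) (repairSet P H' a) := by
  rw [Finset.disjoint_left]
  intro b hb hb'
  obtain ⟨hba, σ, hσ, hbσ⟩ := mem_repairSet.1 hb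
  obtain ⟨-, τ, hτ, hbτ⟩ := mem_repairSet.1 hb'
  obtain rfl : σ = τ := hinj (hH hσ) (hH' hτ) (hbσ.symm.trans hbτ)
  rw [hone σ hσ hτ, Place.map_aut_one] at hbσ
  exact hba (hP hbσ)

open Classical in
/-- Lagrange interpolation on an orbit: `z` is constant on it, so there `f` is a polynomial of
degree less than `r` in `w`, and `w` separates the `r` remaining places. -/
theorem eval_eq_interpolate {P : Fin n → Place K F} (hP : Function.Injective P)
    {H : Subgroup (F ≃ₐ[K] F)} {r t : ℕ} {z w : F} (hz : z ∈ IntermediateField.fixedField H)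
    {a : Fin n} (hrat : ∀ b, (P b).IsRational) (hzreg : ∀ b, z ∈ (P b).ring)
    (hwreg : ∀ b, w ∈ (P b).ring)
    (hwinj : Set.InjOn (fun P' : Place K F => P'.eval w) ((P a).orbit H))
    (hcard : (repairSet P H a).card = r) {f : F} (hf : f ∈ codeSpace K r t z w) :
    (P a).eval f = (Lagrange.interpolate (repairSet P H a) (fun b => (P b).eval w)
      (fun b => (P b).eval f)).eval ((P a).eval w) := by
  obtain ⟨h, hdeg, hh⟩ := Place.exists_polynomial_of_mem_codeSpace hf ((P a).eval z)
  rw [← Lagrange.eq_interpolate_of_eval_eq (f := h)]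
  · exact hh _ (hrat a) (hzreg a) (hwreg a) rfl
  · intro b hb c hc hbc
    exact hP (hwinj (mem_repairSet.1 hb).2 (mem_repairSet.1 hc).2 hbc)
  · rwa [hcard]
  · intro b hb
    refine (hh _ (hrat b) (hzreg b) (hwreg b) ?_).symm
    obtain ⟨-, σ, hσ, hbσ⟩ := mem_repairSet.1 hb
    have hfix : σ.symm z = z := (IntermediateField.mem_fixedField_iff H _).1 hz σ⁻¹ (inv_mem hσ)
    have hratb := hrat b
    rw [hbσ] at hratb ⊢
    rw [Place.eval_map (hrat a) hratb (by rw [hfix]; exact hzreg a), hfix]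

/-- A function of `E'` whose only pole in `E'` lies below the totally ramified place `P₀` is regular
at all other places of `F`, since these do not restrict to the same place of `E'`. -/
theorem mem_ring_of_poles_eq (hF : IsFunctionField K F) {E E' : IntermediateField K F}
    (hEE' : E ≤ E') [FiniteDimensional E' F] (hn : 0 < Module.finrank E F) {P₀ : Place K F}
    (hram : P₀.IsTotallyRamified E) {Q : Place K E'} (hQ : P₀.LiesOver Q) {z : E'}
    (hz : poles K z = {Q}) {P : Place K F} (hP : P ≠ P₀) : (z : F) ∈ P.ring := by
  by_contra hcon
  have hmem : P.restrict E' ∈ poles K z := hcon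
  rw [hz, Set.mem_singleton_iff] at hmem
  refine hP (hram.eq_of_forall_mem P hF hn fun x hx => ?_)
  have h1 : (⟨x, hEE' x.2⟩ : E') ∈ Q.ring := (hQ.mem_iff _).2 hx
  rw [← hmem] at h1
  exact h1

theorem mem_ring_of_poles_eq_singleton {P₀ : Place K F} {w : F} (hw : poles K w = {P₀})
    {P : Place K F} (hP : P ≠ P₀) : w ∈ P.ring := by
  by_contra hcon
  have : P ∈ poles K w := hcon
  rw [hw] at this
  exact hP this

theorem riemannRoch_single_mem (hF : IsFunctionField K F) {P₀ : Place K F} {t : F}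
    (ht : P₀.IsUniformizer t) {k : ℕ} {f : F} (hf : f ∈ riemannRoch (Finsupp.single P₀ (k : ℤ))) :
    (∀ P : Place K F, P ≠ P₀ → f ∈ P.ring) ∧ P₀.val (f * t ^ k) ≤ 1 := by
  constructor
  · intro P hP
    have h := hf P
    rw [Finsupp.single_eq_of_ne hP, neg_zero] at h
    exact (P.zero_le_ord_iff hF f).1 h
  · have h := hf P₀
    rw [Finsupp.single_eq_same, P₀.le_ord_iff hF ht, zpow_neg, zpow_natCast] at h
    rw [map_mul, map_pow]
    calc _ ≤ (P₀.val t ^ k)⁻¹ * P₀.val t ^ k := mul_le_mul_left h _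
      _ = 1 := inv_mul_cancel₀ (pow_ne_zero _ ht.val_pos.ne')

end Construction

end LRC

open LRC in
theorem theorem4p1
    {K F : Type*} [Field K] [Finite K] [Field F] [Algebra K F] (hF : IsFunctionField K F)
    (s : ℕ) (hs : 1 ≤ s)
    (H : Fin s → Subgroup (F ≃ₐ[K] F)) (r : Fin s → ℕ)
    (hr : ∀ i, Nat.card (H i) = r i + 1)
    (G : Subgroup (F ≃ₐ[K] F)) (hG : IsInternalDirectProduct H G)
    -- the selected rational places of the fixed field of `G`, and the places of `F` over them
    (m : ℕ) (M : Finset (Place K (IntermediateField.fixedField G))) (hM : M.card = m)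
    (hMrat : ∀ Q ∈ M, Q.IsRational) (hMsplit : ∀ Q ∈ M, Q.IsCompletelySplit)
    (PP : Set (Place K F)) (hPP : PP = {P | ∃ Q ∈ M, P.LiesOver Q})
    (n : ℕ) (hn : n = m * ∏ i, (r i + 1))
    -- the totally ramified rational place and the places under it
    (Pinf : Place K F) (hPinf : Pinf.IsRational)
    (hram : Pinf.IsTotallyRamified (IntermediateField.fixedField G))
    (Qinf : ∀ i, Place K (IntermediateField.fixedField (H i)))
    (hQinf : ∀ i, Pinf.LiesOver (Qinf i))
    -- the functions `z i` and `w i`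
    (z : ∀ i, IntermediateField.fixedField (H i)) (hz : ∀ i, poles K (z i) = {Qinf i})
    (w : Fin s → F) (hw : ∀ i, w i ∉ IntermediateField.fixedField (H i))
    (hwpole : ∀ i, poles K (w i) = {Pinf})
    (hwinj : ∀ i, ∀ P ∈ PP, Set.InjOn (fun P' : Place K F => P'.eval (w i)) (P.orbit (H i)))
    -- the spaces `V_i` and `V`
    (t : Fin s → ℕ) (ht : ∀ i, 1 ≤ t i)
    (d : ℕ) (hd : 1 ≤ d) (hdn : d ≤ n)
    (hV : ∀ i, (codeSpace K (r i) (t i) (z i : F) (w i) : Set F) ⊆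
      riemannRoch (Finsupp.single Pinf ((n : ℤ) - (d : ℤ))))
    (V : Submodule K F) (hVdef : V = ⨅ i, codeSpace K (r i) (t i) (z i : F) (w i))
    (hVpos : 0 < Module.finrank K V) :
    PP.ncard = n ∧
    -- the evaluation map is meaningful
    (∀ P ∈ PP, P.IsRational ∧ ∀ f ∈ V, f ∈ P.ring) ∧
    -- for every enumeration `P` of the `n` places
    ∀ P : Fin n → Place K F, Function.Injective P → Set.range P = PP →
      (∃ C : Submodule K (Fin n → K),
        (C : Set (Fin n → K)) = (fun (f : F) (a : Fin n) => (P a).eval f) '' (V : Set F) ∧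
        IsLocallyRecoverable C (Module.finrank K V) d r) ∧
      -- the orbits are repair sets, and recovery is by Lagrange interpolation
      ∀ a : Fin n,
        (∀ i j, i ≠ j → Disjoint (repairSet P (H i) a) (repairSet P (H j) a)) ∧
        ∀ i, (repairSet P (H i) a).card = r i ∧
          ∀ f ∈ V, (P a).eval f =
            (Lagrange.interpolate (repairSet P (H i) a) (fun b => (P b).eval (w i))
              (fun b => (P b).eval f)).eval ((P a).eval (w i)) := by
  classical
  have hHfin : ∀ i, Finite (H i) := fun i => Nat.finite_of_card_ne_zero (by rw [hr i]; omega)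
  have hcardG : Nat.card G = ∏ i, (r i + 1) := by
    rw [hG.card_eq]
    exact Finset.prod_congr rfl fun i _ => hr i
  have hGfin : Finite G := Nat.finite_of_card_ne_zero (by
    rw [hcardG]
    exact Finset.prod_ne_zero_iff.2 fun i _ => Nat.succ_ne_zero _)
  have hfinrank : ∀ (H' : Subgroup (F ≃ₐ[K] F)) [Finite H'],
      0 < Module.finrank (IntermediateField.fixedField H') F := fun H' _ => by
    rw [Place.finrank_fixedField]
    exact Nat.card_pos
  have hGnt : 1 < Nat.card G := by
    by_contra hcon
    have hsub : Subsingleton G :=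
      (Nat.card_eq_one_iff_unique.1 (le_antisymm (not_lt.1 hcon) Nat.card_pos)).1
    refine hw ⟨0, hs⟩ ((IntermediateField.mem_fixedField_iff _ _).2 fun σ hσ => ?_)
    have : (⟨σ, hG.le _ hσ⟩ : G) = 1 := Subsingleton.elim _ _
    rw [show σ = 1 from congrArg Subtype.val this]
    rfl
  have hncard : ∀ Q ∈ M, {P : Place K F | P.LiesOver Q}.ncard = Nat.card G := fun Q hQ => by
    rw [(hMsplit Q hQ).2, Place.finrank_fixedField]
  have hPPcard : PP.ncard = n := by
    have hU : PP = ⋃ Q ∈ (M : Set (Place K (IntermediateField.fixedField G))),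
        {P : Place K F | P.LiesOver Q} := by
      rw [hPP]
      ext P
      simp
    rw [hU, M.finite_toSet.ncard_biUnion]
    · rw [finsum_mem_coe_finset, Finset.sum_congr rfl hncard, Finset.sum_const, hM, hcardG, hn,
        smul_eq_mul]
    · intro Q hQ
      exact Set.finite_of_ncard_pos (by rw [hncard Q hQ]; exact Nat.card_pos)
    · intro Q _ Q' _ hne
      refine Set.disjoint_left.2 fun P hP hP' => hne (Place.ext ?_)
      exact Eq.trans hP (Eq.symm hP')
  have hne : ∀ P ∈ PP, P ≠ Pinf := by
    rintro P hP rfl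
    rw [hPP] at hP
    obtain ⟨Q, hQ, hPQ⟩ := hP
    -- a totally ramified place is alone in its fibre, a split fibre has `#G > 1` places
    have hsub : {P' : Place K F | P'.LiesOver Q} ⊆ {P} := fun P' hP' =>
      hram.eq_of_forall_mem P' hF (hfinrank G) fun x hx => (hP'.mem_iff x).1 ((hPQ.mem_iff x).2 hx)
    have := Set.ncard_le_ncard hsub
    rw [hncard Q hQ, Set.ncard_singleton] at this
    omega
  have hPPrat : ∀ P ∈ PP, P.IsRational := by
    intro P hP
    rw [hPP] at hP
    obtain ⟨Q, hQ, hPQ⟩ := hP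
    exact P.isRational_of_isCompletelySplit hF hPQ (hMsplit Q hQ) (hMrat Q hQ)
  have hPPinj : ∀ P ∈ PP, Set.InjOn (fun σ : F ≃ₐ[K] F => P.map σ) G := by
    intro P hP
    rw [hPP] at hP
    obtain ⟨Q, hQ, hPQ⟩ := hP
    exact P.map_injOn hF hPQ (hMsplit Q hQ)
  have hPPorbit : ∀ P ∈ PP, ∀ i, P.orbit (H i) ⊆ PP := by
    rintro P hP i _ ⟨σ, hσ, rfl⟩
    rw [hPP] at hP ⊢
    obtain ⟨Q, hQ, hPQ⟩ := hP
    exact ⟨Q, hQ, hPQ.map (hG.le i hσ)⟩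
  obtain ⟨t₀, ht₀⟩ := Pinf.exists_isUniformizer hF
  have hVle : ∀ i, V ≤ codeSpace K (r i) (t i) (z i : F) (w i) := fun i => hVdef ▸ iInf_le _ i
  have hVmem : ∀ f ∈ V, (∀ P : Place K F, P ≠ Pinf → f ∈ P.ring) ∧
      Pinf.val (f * t₀ ^ (n - d)) ≤ 1 := by
    intro f hf
    refine riemannRoch_single_mem hF ht₀ ?_
    rw [Nat.cast_sub hdn]
    exact hV ⟨0, hs⟩ (hVle _ hf)
  have hzreg : ∀ i, ∀ P ∈ PP, (z i : F) ∈ P.ring := fun i P hP => by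
    have := FiniteDimensional.of_finrank_pos (hfinrank (H i))
    exact mem_ring_of_poles_eq hF (IntermediateField.fixedField_le (hG.le i)) (hfinrank G) hram
      (hQinf i) (hz i) (hne P hP)
  have hwreg : ∀ i, ∀ P ∈ PP, w i ∈ P.ring := fun i P hP =>
    mem_ring_of_poles_eq_singleton (hwpole i) (hne P hP)
  have hVreg : ∀ P ∈ PP, ∀ f ∈ V, f ∈ P.ring := fun P hP f hf => (hVmem f hf).1 P (hne P hP)
  refine ⟨hPPcard, fun P hP => ⟨hPPrat P hP, hVreg P hP⟩, fun P hPinj hPrange => ?_⟩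
  have hPmem : ∀ a, P a ∈ PP := fun a => hPrange ▸ Set.mem_range_self a
  have hdisj : ∀ a i j, i ≠ j → Disjoint (repairSet P (H i) a) (repairSet P (H j) a) :=
    fun a i j hij => disjoint_repairSet hPinj (hG.le i) (hG.le j)
      (fun σ => hG.eq_one hij) (hPPinj _ (hPmem a))
  have hcard : ∀ a i, (repairSet P (H i) a).card = r i := fun a i => by
    have := card_repairSet hPinj ((hPPinj _ (hPmem a)).mono (hG.le i))
      (hPrange ▸ hPPorbit _ (hPmem a) i)
    rw [hr i] at this
    omega
  have hinterp : ∀ a i, ∀ f ∈ V, (P a).eval f =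
      (Lagrange.interpolate (repairSet P (H i) a) (fun b => (P b).eval (w i))
        (fun b => (P b).eval f)).eval ((P a).eval (w i)) := fun a i f hf => by
    convert eval_eq_interpolate hPinj (z i).2 (fun b => hPPrat _ (hPmem b))
      (fun b => hzreg i _ (hPmem b)) (fun b => hwreg i _ (hPmem b)) (hwinj i _ (hPmem a))
      (hcard a i) (hVle i hf)
  refine ⟨?_, fun a => ⟨hdisj a, fun i => ⟨hcard a i, hinterp a i⟩⟩⟩
  let φ : V →ₗ[K] (Fin n → K) :=
    { toFun := fun f a => (P a).eval (f : F)
      map_add' := fun f g => funext fun a => (P a).eval_add (hPPrat _ (hPmem a))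
        (hVreg _ (hPmem a) f f.2) (hVreg _ (hPmem a) g g.2)
      map_smul' := fun c f => funext fun a => by
        change (P a).eval ((c • f : V) : F) = c * (P a).eval (f : F)
        rw [Submodule.coe_smul, Algebra.smul_def, (P a).eval_mul (hPPrat _ (hPmem a))
          ((P a).const_mem c) (hVreg _ (hPmem a) f f.2), (P a).eval_const (hPPrat _ (hPmem a))] }
  have hzeros : ∀ f : V, f ≠ 0 → ∀ Z : Finset (Fin n), (∀ a ∈ Z, φ f a = 0) → Z.card + d ≤ n := by
    intro f hf Z hZ
    have h := Place.card_zeros_le hF hPinf ht₀ (f := (f : F)) (by simpa using hf)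
      (hVmem f f.2).1 (hVmem f f.2).2 (Z.image P) (fun R hR => by
        obtain ⟨a, ha, rfl⟩ := Finset.mem_image.1 hR
        exact ((P a).eval_eq_zero_iff (hPPrat _ (hPmem a)) (hVreg _ (hPmem a) f f.2)).1 (hZ a ha))
    rw [Finset.card_image_of_injective _ hPinj] at h
    omega
  have hφinj : Function.Injective φ := by
    rw [← LinearMap.ker_eq_bot, LinearMap.ker_eq_bot']
    intro f hf
    by_contra h0
    have := hzeros f h0 Finset.univ (fun a _ => congrFun hf a)
    rw [Finset.card_univ, Fintype.card_fin] at this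
    omega
  have hrank : Module.finrank K (LinearMap.range φ) = Module.finrank K V :=
    LinearMap.finrank_range_of_inj hφinj
  refine ⟨LinearMap.range φ, ?_, hrank ▸ isLocallyRecoverable_of_forall ?_
    (fun a i => repairSet P (H i) a) hdisj (fun a i h => (mem_repairSet.1 h).1 rfl) hcard ?_⟩
  · ext x
    constructor
    · rintro ⟨f, rfl⟩
      exact ⟨f, f.2, rfl⟩
    · rintro ⟨f, hf, rfl⟩
      exact ⟨⟨f, hf⟩, rfl⟩
  · refine le_minDist ?_ ?_
    · intro hbot
      rw [hbot, finrank_bot] at hrank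
      omega
    · rintro _ ⟨f, rfl⟩ hf Z hZ
      exact hzeros f (fun h => hf (by rw [h, map_zero])) Z hZ
  · -- the coefficients are the values of the Lagrange basis at the erased place
    intro a i
    refine ⟨fun b => (Lagrange.basis (repairSet P (H i) a) (fun b => (P b).eval (w i)) b).eval
      ((P a).eval (w i)), ?_⟩
    rintro _ ⟨f, rfl⟩
    change (P a).eval (f : F) = ∑ b ∈ _, _ * (P b).eval (f : F)
    rw [hinterp a i f f.2, Lagrange.interpolate_apply, Polynomial.eval_finsetSum]
    refine Finset.sum_congr rfl fun b _ => ?_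
    rw [Polynomial.eval_mul, Polynomial.eval_C, mul_comm]
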